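/- **Conventions.** A geodesic metric space $\mathcal Z$ is $\delta$-hyperbolic if all its geodesic triangles are $\delta$-slim. Fix once and for all, for any two finite non-empty subsets $C,C'\subset\mathcal Z$, a geodesic $\lambda(C,C'):[0,d(C,C')]\to\mathcal Z$ joining them, of length $d(C,C')=\min\{d(x,y):x\in C,\ y\in C'\}$, with $\lambda(C,C')=\lambda(C',C)$; write $\lambda(x,y)=\lambda(\{x\},\{y\})$, and let $\lambda_0(C,C')$ be the restriction of $\lambda(C,C')$ to $[0,\lfloor d(C,C')\rfloor]$. *Setups.* For $\epsilon>0$, an $\epsilon$-setup $(a,b;\mathcal Y)$ consists of $a,b\in\mathcal Z$ and a finite set $\mathcal Y\subset\mathcal Z$ with $d(y,\lambda(a,b))<\epsilon/2$ for all $y\in\mathcal Y$. Two $\epsilon$-setups $(a,b;\mathcal Y)$, $(a',b';\mathcal Y')$ are $(N,\epsilon)$-admissible if $d(a,a')\le\epsilon$, $d(b,b')\le\epsilon$, every $y\in\mathcal Y\cup\mathcal Y'$ satisfies $d(y,\lambda(a,b))<\epsilon/2$ and $d(y,\lambda(a',b'))<\epsilon/2$, and $|\mathcal Y\triangle\mathcal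 Y'|<N$. *Clusters.* For $E>0$, the clusters of $(a,b;\mathcal Y)$ are the connected components of the graph on $\mathcal Y\cup\{a,b\}$ in which distinct $x,y$ are joined when $d(x,y)<E$. A cluster $C_2$ $e$-separates $C_1$ from $C_3$ if some minimal length geodesic from $C_1$ to $C_3$ passes within $2e$ of $C_2$. In the cluster separation graph $\mathcal G_{E,\epsilon'}$ two distinct clusters are joined when no other cluster $2\epsilon'$-separates them. *Stable intervals.* Suppose $\mathcal G_{E,\epsilon'}$ is a path $C_0,\dots,C_n$ with $a\in C_0$, $b\in C_n$. The stable interval is the abstract interval $T=T_e\cup T_c$ obtained by concatenating $\mu(C_0),\lambda_0(C_0,C_1),\mu(C_1),\dots,\lambda_0(C_{n-1},C_n),\mu(C_n)$. Here $r(C_i)$ is the intersection of $C_i$ with the union of $\{a,b\}$ and the geodesics $\lambda(C_i,C_{i\pm1})$, $\mu(C_i)=\lambda(r(C_i))$ is the geodesic spanned by its (at most two) points, the edge components $\lambda_0(C_i,C_{i+1})$ make up $T_e$ and the cluster components $\mu(C_i)$ make up $T_c$. Let $\phi:T\to\mathcal Z$ be the map induced by these geodesics. The vertices of an edge component are its points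 at integer distance from its ends. *Thickenings.* The $(r_1,r_2)$-thickening of $T$ along $T_c$ is $T=\mathbb T_e\cup\mathbb T_c$, where $\mathbb T_c$ is the union of the open $r_1$-neighbourhoods in $T$ of the components of $T_c$ and of the geodesics in $T$ joining any two of these neighbourhoods at distance at most $r_2$, and $\mathbb T_e=T-\mathbb T_c\subset T_e$. *Compatible decompositions.* An edge decomposition of $T_e$ (or of $\mathbb T_e$) is a finite collection $T_s$ of closed subintervals of its components, disjoint within each component; these are the components of $T_s$. The components of $T-T_s$ are taken with their endpoints, so that every $\mu(C)$ lies in exactly one of them. Given $\mathcal Y_0\subset\mathcal Y\cap\mathcal Y'$, edge decompositions $T_s,T'_s$ for two setups are $\mathcal Y_0$-stably $L$-compatible if: (a) all their components have positive integer length and endpoints at vertices; (b) they have equally many components; let $\alpha:\pi_0(T_s)\to\pi_0(T'_s)$ and $\beta:\pi_0(T-T_s)\to\pi_0(T'-T'_s)$ be the order-preserving bijections, order being from the $a$-side to the $b$-side (resp. $a'$, $b'$); (c) for each stable pair $(F,F'=\alpha(F))$ there is an order-preserving isometry $i_{F,F'}:F\to F'$; (d) for all but at most $L$ stable pairs, $\phi(x)=\phi'(i_{F,F'}(x))$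 for all $x\in F$; (e) for the remaining stable pairs, $d(\phi(x),\phi'(i_{F,F'}(x)))<L$ for all $x\in F$; (f) each of the complements of $T_s$, $T'_s$ in the respective edge parts has at most $L$ components, each of diameter at most $L$; (g) $\beta$ sends the component containing the $\mu$ of the cluster of $a$ to the one containing the $\mu$ of the cluster of $a'$, likewise for $b$ and $b'$, and for each $y\in\mathcal Y_0$ it sends the component containing the $\mu$ of the cluster of $y$ for the first setup to the one containing the $\mu$ of the cluster of $y$ for the second. **Theorem (Stable intervals).** Let $\delta$ be a real number and $\epsilon>0$. For all $\epsilon'$ sufficiently large in terms of $\delta,\epsilon$ and all $E$ sufficiently large in terms of $\delta,\epsilon,\epsilon'$ the following holds. For every $N>0$ there is $L_1>0$, and for all positive integers $r_1,r_2$ there is $L_2>0$, where $L_1$ depends only on $\delta,\epsilon,\epsilon',E,N$ and $L_2$ only on these and $r_1,r_2$, such that for every $\delta$-hyperbolic geodesic space $\mathcal Z$, every choice of $\lambda$ as above and all $(N,\epsilon)$-admissible $\epsilon$-setups $(a,b;\mathcal Y)$, $(a',b';\mathcal Y')$ in $\mathcal Z$: the cluster separation graphs $\mathcal G_{E,\epsilon'}$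 of both setups are paths from the cluster of $a$ (resp. $a'$) to the cluster of $b$ (resp. $b'$), so that the stable intervals $T=T_e\cup T_c$ and $T'=T'_e\cup T'_c$ are defined, and 1. there exist $(\mathcal Y\cap\mathcal Y')$-stably $L_1$-compatible edge decompositions $T_s\subset T_e$ and $T'_s\subset T'_e$; 2. there exist $(\mathcal Y\cap\mathcal Y')$-stably $L_2$-compatible edge decompositions $\mathbb T_s\subset\mathbb T_e$ and $\mathbb T'_s\subset\mathbb T'_e$ of the $(r_1,r_2)$-thickenings of $T,T'$ along $T_c,T'_c$, and moreover $\mathbb T_s\subset T_s$ and $\mathbb T'_s\subset T'_s$. -/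

import Mathlib

noncomputable section

namespace StableIntervals

/-! ### Geodesics and hyperbolicity -/

/-- `γ`, restricted to `[0, dist x y]`, is a geodesic from `x` to `y`. -/
def IsGeodesicSegment {Z : Type*} [MetricSpace Z] (γ : ℝ → Z) (x y : Z) : Prop :=
  γ 0 = x ∧ γ (dist x y) = y ∧
    ∀ s ∈ Set.Icc 0 (dist x y), ∀ t ∈ Set.Icc 0 (dist x y), dist (γ s) (γ t) = |s - t|

/-- A geodesic metric space all of whose geodesic triangles are `δ`-slim.  (As the order of the
vertices and the directions of the sides are arbitrary, `slim` applies to each of the three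
sides of a triangle.) -/
structure IsHyperbolicGeodesicSpace (δ : ℝ) (Z : Type*) [MetricSpace Z] : Prop where
  exists_geodesic : ∀ x y : Z, ∃ γ : ℝ → Z, IsGeodesicSegment γ x y
  slim : ∀ (x y z : Z) (α β γ : ℝ → Z),
    IsGeodesicSegment α x y → IsGeodesicSegment β y z → IsGeodesicSegment γ x z →
    ∀ t ∈ Set.Icc 0 (dist x y),
      (∃ s ∈ Set.Icc 0 (dist y z), dist (α t) (β s) ≤ δ) ∨
      (∃ s ∈ Set.Icc 0 (dist x z), dist (α t) (γ s) ≤ δ)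

/-- The distance `d(A, B) = inf {d(x, y) : x ∈ A, y ∈ B}` between two sets. -/
def setDist {X : Type*} [MetricSpace X] (A B : Set X) : ℝ := sInf (Set.image2 dist A B)

/-- A choice `λ`, fixed once and for all, of a geodesic `λ(C, C')` between any two finite
non-empty subsets, of length `d(C, C')` and with `λ(C, C') = λ(C', C)`.  The geodesic between two
points `x`, `y` is `λ({x}, {y})`.  Because of the symmetry, `λ(C, C')` may start in either of the
two sets. -/
structure GeodesicChoice (Z : Type*) [MetricSpace Z] where
  path : Set Z → Set Z → ℝ → Z
  symm : ∀ C C' : Set Z, C.Finite → C.Nonempty → C'.Finite → C'.Nonempty →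
    path C C' = path C' C
  isometry : ∀ C C' : Set Z, C.Finite → C.Nonempty → C'.Finite → C'.Nonempty →
    ∀ s ∈ Set.Icc 0 (setDist C C'), ∀ t ∈ Set.Icc 0 (setDist C C'),
      dist (path C C' s) (path C C' t) = |s - t|
  endpoints : ∀ C C' : Set Z, C.Finite → C.Nonempty → C'.Finite → C'.Nonempty →
    (path C C' 0 ∈ C ∧ path C C' (setDist C C') ∈ C') ∨
    (path C C' 0 ∈ C' ∧ path C C' (setDist C C') ∈ C)

/-- The image of `λ(C, C')`. -/
def GeodesicChoice.carrier {Z : Type*} [MetricSpace Z] (lam : GeodesicChoice Z)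
    (C C' : Set Z) : Set Z :=
  lam.path C C' '' Set.Icc 0 (setDist C C')

/-! ### Setups -/

/-- `(a, b; Y)` is an `ε`-setup. -/
def IsSetup {Z : Type*} [MetricSpace Z] (lam : GeodesicChoice Z) (ε : ℝ) (a b : Z)
    (Y : Finset Z) : Prop :=
  ∀ y ∈ Y, Metric.infDist y (lam.carrier {a} {b}) < ε / 2

/-- `(a, b; Y)` and `(a', b'; Y')` are `(N, ε)`-admissible `ε`-setups. -/
structure IsAdmissible {Z : Type*} [MetricSpace Z] (lam : GeodesicChoice Z) (N ε : ℝ)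
    (a b : Z) (Y : Finset Z) (a' b' : Z) (Y' : Finset Z) : Prop where
  setup : IsSetup lam ε a b Y
  setup' : IsSetup lam ε a' b' Y'
  dist_a : dist a a' ≤ ε
  dist_b : dist b b' ≤ ε
  close : ∀ y, (y ∈ Y ∨ y ∈ Y') →
    Metric.infDist y (lam.carrier {a} {b}) < ε / 2 ∧
    Metric.infDist y (lam.carrier {a'} {b'}) < ε / 2
  card_symmDiff : ((symmDiff (Y : Set Z) (Y' : Set Z)).ncard : ℝ) < N

/-! ### Clusters and the cluster separation graph -/

/-- The points that are grouped into clusters: `Y ∪ {a, b}`. -/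
def vertexSet {Z : Type*} (a b : Z) (Y : Finset Z) : Set Z := (Y : Set Z) ∪ {a, b}

/-- The graph on `V` in which two distinct points are joined when their distance is `< E`. -/
def proximityGraph {Z : Type*} [MetricSpace Z] (E : ℝ) (V : Set Z) : SimpleGraph V where
  Adj x y := x ≠ y ∧ dist (x : Z) (y : Z) < E
  symm := ⟨fun x y h => ⟨h.1.symm, by rw [dist_comm]; exact h.2⟩⟩
  loopless := ⟨fun _ h => h.1 rfl⟩

/-- `C` is an `E`-cluster of `V`: a connected component of the proximity graph. -/
def IsCluster {Z : Type*} [MetricSpace Z] (E : ℝ) (V : Set Z) (C : Set Z) : Prop :=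
  ∃ c : (proximityGraph E V).ConnectedComponent, C = Subtype.val '' c.supp

/-- `C₂` `e`-separates `C₁` from `C₃`: some minimal length geodesic connecting `C₁` to `C₃` passes
within `2e` of `C₂`. -/
def Separates {Z : Type*} [MetricSpace Z] (e : ℝ) (C₂ C₁ C₃ : Set Z) : Prop :=
  ∃ x ∈ C₁, ∃ y ∈ C₃, dist x y = setDist C₁ C₃ ∧ ∃ γ : ℝ → Z, IsGeodesicSegment γ x y ∧
    ∃ t ∈ Set.Icc 0 (dist x y), ∃ c ∈ C₂, dist (γ t) c ≤ 2 * e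

theorem setDist_comm {X : Type*} [MetricSpace X] (A B : Set X) : setDist A B = setDist B A := by
  unfold setDist
  rw [Set.image2_swap]
  simp only [dist_comm]

theorem IsGeodesicSegment.reverse {Z : Type*} [MetricSpace Z] {γ : ℝ → Z} {x y : Z}
    (h : IsGeodesicSegment γ x y) : IsGeodesicSegment (fun t => γ (dist x y - t)) y x := by
  refine ⟨by simpa using h.2.1, by simpa [dist_comm y x] using h.1, fun s hs t ht => ?_⟩
  rw [dist_comm y x, Set.mem_Icc] at hs ht
  rw [h.2.2 _ ⟨by linarith, by linarith⟩ _ ⟨by linarith, by linarith⟩, abs_sub_comm]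
  congr 1
  ring

theorem Separates.symm {Z : Type*} [MetricSpace Z] {e : ℝ} {C₂ C₁ C₃ : Set Z}
    (h : Separates e C₂ C₁ C₃) : Separates e C₂ C₃ C₁ := by
  obtain ⟨x, hx, y, hy, hd, γ, hγ, t, ht, c, hc, hct⟩ := h
  refine ⟨y, hy, x, hx, by rw [dist_comm, hd, setDist_comm], _, hγ.reverse, dist x y - t, ?_,
    c, hc, by simpa using hct⟩
  rw [Set.mem_Icc] at ht
  rw [dist_comm y x]
  exact ⟨by linarith, by linarith⟩

/-- The `E`-cluster separation graph: its vertices are the `E`-clusters of `V`, and two of them are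
joined when they are not `2ε'`-separated by another cluster. -/
def separationGraph {Z : Type*} [MetricSpace Z] (E ε' : ℝ) (V : Set Z) :
    SimpleGraph {C : Set Z // IsCluster E V C} where
  Adj C C' := C ≠ C' ∧ ∀ D : {C : Set Z // IsCluster E V C}, D ≠ C → D ≠ C' →
    ¬ Separates (2 * ε') D.1 C.1 C'.1
  symm := ⟨fun _ _ h => ⟨h.1.symm, fun D h₁ h₂ hD => h.2 D h₂ h₁ hD.symm⟩⟩
  loopless := ⟨fun _ h => h.1 rfl⟩

/-- The structure of an interval on the cluster separation graph of `(a, b; Y)`: an identification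
with the path graph on `0, …, n`, whose first vertex is the cluster that contains `a` and whose
last vertex is the cluster that contains `b`. -/
structure ClusterOrder {Z : Type*} [MetricSpace Z] (E ε' : ℝ) (a b : Z) (Y : Finset Z) where
  n : ℕ
  iso : SimpleGraph.pathGraph (n + 1) ≃g separationGraph E ε' (vertexSet a b Y)
  a_mem : a ∈ (iso 0).1
  b_mem : b ∈ (iso (Fin.last n)).1

/-! ### The stable interval

The stable interval is the interval `T = [0, total]` of real numbers, which is the concatenation of
cluster component `0`, edge component `0`, cluster component `1`, edge component `1`, …, cluster
component `n`, each a segment with the length of the corresponding geodesic of `Z`. -/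

namespace ClusterOrder

variable {Z : Type*} [MetricSpace Z] {E ε' : ℝ} {a b : Z} {Y : Finset Z}

/-- The `i`-th cluster, counted from `a` to `b`. -/
def cluster (O : ClusterOrder E ε' a b Y) (i : Fin (O.n + 1)) : Set Z := (O.iso i).1

/-- `r(C) = C ∩ (λ(C₁, C) ∪ λ(C, C₂) ∪ {a, b})`, with `C₁`, `C₂` the clusters adjacent to `C`. -/
def attachingSet (lam : GeodesicChoice Z) (O : ClusterOrder E ε' a b Y) (i : Fin (O.n + 1)) :
    Set Z :=
  O.cluster i ∩
    ((⋃ (j : Fin (O.n + 1)) (_ : (SimpleGraph.pathGraph (O.n + 1)).Adj j i),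
      lam.carrier (O.cluster j) (O.cluster i)) ∪ {a, b})

/-- The geodesic `μ(C) = λ(r(C))` in `Z`, where `r(C)` consists of one or two points. -/
def mu (lam : GeodesicChoice Z) (O : ClusterOrder E ε' a b Y) (i : Fin (O.n + 1)) : Set Z :=
  ⋃ (p ∈ O.attachingSet lam i) (q ∈ O.attachingSet lam i), lam.carrier {p} {q}

/-- The length of the geodesic `μ(C)`. -/
def clusterLength (lam : GeodesicChoice Z) (O : ClusterOrder E ε' a b Y) (i : Fin (O.n + 1)) : ℝ :=
  Metric.diam (O.mu lam i)

/-- The length `⌊d(C, C')⌋` of the trimmed geodesic `λ₀(C, C')` between consecutive clusters. -/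
def edgeLength (O : ClusterOrder E ε' a b Y) (i : Fin O.n) : ℝ :=
  (⌊setDist (O.cluster i.castSucc) (O.cluster i.succ)⌋ : ℝ)

/-- Left endpoint in `T` of the cluster component `i`. -/
def clusterLo (lam : GeodesicChoice Z) (O : ClusterOrder E ε' a b Y) (i : Fin (O.n + 1)) : ℝ :=
  ∑ j : Fin O.n with j.castSucc < i, (O.clusterLength lam j.castSucc + O.edgeLength j)

/-- Right endpoint in `T` of the cluster component `i`. -/
def clusterHi (lam : GeodesicChoice Z) (O : ClusterOrder E ε' a b Y) (i : Fin (O.n + 1)) : ℝ :=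
  O.clusterLo lam i + O.clusterLength lam i

/-- The cluster component `i` as a segment of `T`; the family of these is `T_c`. -/
def clusterSeg (lam : GeodesicChoice Z) (O : ClusterOrder E ε' a b Y) (i : Fin (O.n + 1)) :
    Set ℝ :=
  Set.Icc (O.clusterLo lam i) (O.clusterHi lam i)

/-- Left endpoint in `T` of the edge component `i`. -/
def edgeLo (lam : GeodesicChoice Z) (O : ClusterOrder E ε' a b Y) (i : Fin O.n) : ℝ :=
  O.clusterHi lam i.castSucc

/-- Right endpoint in `T` of the edge component `i`. -/
def edgeHi (lam : GeodesicChoice Z) (O : ClusterOrder E ε' a b Y) (i : Fin O.n) : ℝ :=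
  O.edgeLo lam i + O.edgeLength i

/-- The edge component `i` as a segment of `T`; the family of these is `T_e`. -/
def edgeSeg (lam : GeodesicChoice Z) (O : ClusterOrder E ε' a b Y) (i : Fin O.n) : Set ℝ :=
  Set.Icc (O.edgeLo lam i) (O.edgeHi lam i)

/-- The stable interval `T`, as an abstract interval. -/
def interval (lam : GeodesicChoice Z) (O : ClusterOrder E ε' a b Y) : Set ℝ :=
  Set.Icc 0 (O.clusterHi lam (Fin.last O.n))

open Classical in
/-- The map `φ : T → Z` on the edge component `i`: it is the restriction `λ₀(C, C')` of `λ(C, C')`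
to `[0, ⌊d(C, C')⌋]`, run through from the side of `C` to the side of `C'`. -/
def phi (lam : GeodesicChoice Z) (O : ClusterOrder E ε' a b Y) (i : Fin O.n) (x : ℝ) : Z :=
  if lam.path (O.cluster i.castSucc) (O.cluster i.succ) 0 ∈ O.cluster i.castSucc then
    lam.path (O.cluster i.castSucc) (O.cluster i.succ) (x - O.edgeLo lam i)
  else
    lam.path (O.cluster i.castSucc) (O.cluster i.succ) (O.edgeHi lam i - x)

end ClusterOrder

/-! ### Thickenings -/

/-- The `r`-neighbourhood of `B` in the interval `T`. -/
def nbhdIn (T : Set ℝ) (r : ℝ) (B : Set ℝ) : Set ℝ := {x ∈ T | Metric.infDist x B < r}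

/-- The part `𝕋_c` of the `(r₁, r₂)`-thickening of the interval `T` along the segments `B i`: the
`r₁`-neighbourhoods of the `B i`, any two of which that come within `r₂` of each other are
connected by the geodesic between them (in `ℝ`, this gives the convex hull of their union). -/
def thickCluster {ι : Type*} (T : Set ℝ) (B : ι → Set ℝ) (r₁ r₂ : ℝ) : Set ℝ :=
  ⋃ (i : ι) (j : ι) (_ : setDist (nbhdIn T r₁ (B i)) (nbhdIn T r₁ (B j)) ≤ r₂),
    convexHull ℝ (nbhdIn T r₁ (B i) ∪ nbhdIn T r₁ (B j))

/-- The part `𝕋_e = T - 𝕋_c` of the `(r₁, r₂)`-thickening. -/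
def thickEdge {ι : Type*} (T : Set ℝ) (B : ι → Set ℝ) (r₁ r₂ : ℝ) : Set ℝ :=
  T \ thickCluster T B r₁ r₂

/-- The edge part `𝕋_e ⊆ T_e` of the `(r₁, r₂)`-thickening of the stable interval along `T_c`, listed
by the edge component of `T` in which its pieces lie. -/
def ClusterOrder.thickEdgeSeg {Z : Type*} [MetricSpace Z] {E ε' : ℝ} {a b : Z} {Y : Finset Z}
    (lam : GeodesicChoice Z) (O : ClusterOrder E ε' a b Y) (r₁ r₂ : ℝ) (i : Fin O.n) : Set ℝ :=
  O.edgeSeg lam i ∩ thickEdge (O.interval lam) (O.clusterSeg lam) r₁ r₂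

/-! ### Edge decompositions and stable compatibility -/

/-- An edge decomposition with `k` components: a collection of `k` subintervals of the pieces
`A 0, …, A (n - 1)` of an edge forest, listed in the order in which they appear along the interval.
They are the components of `T_s`, so that two of them in the same piece are disjoint.  Two of them
in consecutive pieces may meet in a point if the cluster component between the pieces is a
point. -/
structure EdgeDecomposition {n : ℕ} (A : Fin n → Set ℝ) (k : ℕ) where
  piece : Fin k → Fin n
  lo : Fin k → ℝ
  hi : Fin k → ℝ
  lo_le_hi : ∀ j, lo j ≤ hi j
  subset : ∀ j, Set.Icc (lo j) (hi j) ⊆ A (piece j)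
  ordered : ∀ i j, i < j → hi i ≤ lo j
  disjoint : ∀ i j, i < j → piece i = piece j → hi i < lo j

namespace EdgeDecomposition

variable {n : ℕ} {A : Fin n → Set ℝ} {k : ℕ}

/-- The `j`-th component of `T_s`. -/
def seg (S : EdgeDecomposition A k) (j : Fin k) : Set ℝ := Set.Icc (S.lo j) (S.hi j)

/-- The components of `T_e - T_s`, taken within each piece of the edge forest. -/
def unstable (S : EdgeDecomposition A k) : Set (Set ℝ) :=
  {D | ∃ i : Fin n, ∃ x ∈ A i \ ⋃ (j : Fin k) (_ : S.piece j = i), S.seg j,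
    D = connectedComponentIn (A i \ ⋃ (j : Fin k) (_ : S.piece j = i), S.seg j) x}

/-- The `j`-th component (`0 ≤ j ≤ k`) of `T - T_s`, with its endpoints: the points of `T` that lie
to the right of the components of `T_s` with index `< j` and to the left of the others. -/
def gap (S : EdgeDecomposition A k) (T : Set ℝ) (j : Fin (k + 1)) : Set ℝ :=
  {x ∈ T | (∀ i : Fin k, i.castSucc < j → S.hi i ≤ x) ∧
    (∀ i : Fin k, j ≤ i.castSucc → x ≤ S.lo i)}

end EdgeDecomposition

/-- The edge decompositions `S` (of the edge forest `A` inside the stable interval of `O`) and `S'`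
(of `A'` inside the stable interval of `O'`) are `Y₀`-stably `L`-compatible.  They have the same
number `k` of components, and the order-preserving bijections `α` of their components and `β` of
the components of the complements are the ones that preserve the index. -/
structure StablyCompatible {Z : Type*} [MetricSpace Z] (lam : GeodesicChoice Z) {E ε' : ℝ}
    {a b a' b' : Z} {Y Y' : Finset Z}
    (O : ClusterOrder E ε' a b Y) (O' : ClusterOrder E ε' a' b' Y')
    {A : Fin O.n → Set ℝ} {A' : Fin O'.n → Set ℝ} {k : ℕ}
    (S : EdgeDecomposition A k) (S' : EdgeDecomposition A' k) (Y₀ : Set Z) (L : ℝ) : Prop where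
  /-- positive integer lengths -/
  length : ∀ j, ∃ m : ℕ, 0 < m ∧ S.hi j - S.lo j = m
  length' : ∀ j, ∃ m : ℕ, 0 < m ∧ S'.hi j - S'.lo j = m
  /-- the endpoints are vertices: points of an edge component at integer distance from its ends -/
  vertex : ∀ j, ∃ m : ℕ, S.lo j = O.edgeLo lam (S.piece j) + m
  vertex' : ∀ j, ∃ m : ℕ, S'.lo j = O'.edgeLo lam (S'.piece j) + m
  /-- order-preserving isometries between the members of stable pairs, with at most `L` pairs that
  are not identical, all pairs being `L`-close -/
  pairs : ∃ i : ∀ j, S.seg j ≃ᵢ S'.seg j,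
    (∀ j, Monotone (i j)) ∧
    (({j | ¬ ∀ x : S.seg j, O.phi lam (S.piece j) x = O'.phi lam (S'.piece j) (i j x)}.ncard : ℝ)
      ≤ L) ∧
    (∀ j, ∀ x : S.seg j,
      dist (O.phi lam (S.piece j) x) (O'.phi lam (S'.piece j) (i j x)) < L)
  /-- at most `L` unstable components, of diameter at most `L` -/
  unstable_finite : S.unstable.Finite ∧ (S.unstable.ncard : ℝ) ≤ L
  unstable_finite' : S'.unstable.Finite ∧ (S'.unstable.ncard : ℝ) ≤ L
  unstable_diam : ∀ D ∈ S.unstable, Metric.diam D ≤ L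
  unstable_diam' : ∀ D ∈ S'.unstable, Metric.diam D ≤ L
  /-- `β(D_a) = D_{a'}` -/
  end_a : ∀ i i', a ∈ O.cluster i → a' ∈ O'.cluster i' → ∃ j,
    O.clusterSeg lam i ⊆ S.gap (O.interval lam) j ∧
    O'.clusterSeg lam i' ⊆ S'.gap (O'.interval lam) j
  /-- `β(D_b) = D_{b'}` -/
  end_b : ∀ i i', b ∈ O.cluster i → b' ∈ O'.cluster i' → ∃ j,
    O.clusterSeg lam i ⊆ S.gap (O.interval lam) j ∧
    O'.clusterSeg lam i' ⊆ S'.gap (O'.interval lam) j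
  /-- `β(D_y) = D'_y` for `y ∈ Y₀` -/
  label : ∀ y ∈ Y₀, ∀ i i', y ∈ O.cluster i → y ∈ O'.cluster i' → ∃ j,
    O.clusterSeg lam i ⊆ S.gap (O.interval lam) j ∧
    O'.clusterSeg lam i' ⊆ S'.gap (O'.interval lam) j

end StableIntervals

end

open StableIntervals

noncomputable section

namespace StableIntervals

/-! ### Coarse geometry of points near a geodesic. -/

section Distances

variable {Z : Type*} [MetricSpace Z]

/-! Everything is projected to the line by `f = dist a`. All points of both setups lie within `ε` of
one geodesic from `a` to `b`, so on them `f` is 1-Lipschitz and distances are recovered up to `η =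
4ε` (`IsCoarseCoordinate`). For `E` large against `η`, distinct clusters occupy `f`-ranges that do
not interleave. A cluster lying between two others separates them by slimness, and an outer one is
too far away to do so. Hence the separation graph is a path, ordered by `f` (`exists_isOrderedBy`),
and this order is unique (`IsOrderedBy.congr`).

Each edge component becomes a segment of the line, starting at the `f`-value of its left end. The
two setups give two `EdgeLayout`s, and the rest is a comparison of intervals. Two segments with
overlap at least `2M + 3` are matched. Equal segments are matched entirely; otherwise the
intersection is cut by about `M` at both ends. Since `M` exceeds the error in the ordering of a
layout, matched parts in one segment are disjoint and the matching is monotone. The matched parts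
are the stable components.

Few things go wrong. An edge not shared by both setups is charged to a nearby point of the symmetric
difference of the vertex sets, each point being charged at most five times (`card_badEdges_le`).
This bounds the unstable components and the pairs that are not identical. Shared edges give
literally equal maps, because the choice of geodesics depends only on the clusters. A long piece of
an edge contains an interval free of points of the symmetric difference, which must lie in a single
edge of the other setup (`isDense_layout`); this bounds the unstable diameters. Matched points have
close `f`-values and lie near a geodesic from `a` to `b`, hence are close.

Thickening merely discards short edges and shortens the others by `r₁`
(`thickEdgeSeg_eq_trimmedSeg`), so the same matched parts, filtered and shortened, serve the second
assertion. -/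

theorem setDist_singleton (x y : Z) : setDist {x} {y} = dist x y := by
  simp [setDist]

theorem setDist_nonneg (A B : Set Z) : 0 ≤ setDist A B := by
  apply Real.sInf_nonneg
  rintro _ ⟨x, _, y, _, rfl⟩
  exact dist_nonneg

theorem setDist_le_dist {A B : Set Z} {x y : Z} (hx : x ∈ A) (hy : y ∈ B) :
    setDist A B ≤ dist x y := by
  refine csInf_le ⟨0, ?_⟩ ⟨x, hx, y, hy, rfl⟩
  rintro _ ⟨x, _, y, _, rfl⟩
  exact dist_nonneg

theorem le_setDist {A B : Set Z} (hA : A.Nonempty) (hB : B.Nonempty) {r : ℝ}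
    (h : ∀ x ∈ A, ∀ y ∈ B, r ≤ dist x y) : r ≤ setDist A B := by
  refine le_csInf (hA.image2 hB) ?_
  rintro _ ⟨x, hx, y, hy, rfl⟩
  exact h x hx y hy

theorem exists_dist_eq_setDist {A B : Set Z} (hA : A.Finite) (hB : B.Finite) (hA' : A.Nonempty)
    (hB' : B.Nonempty) : ∃ x ∈ A, ∃ y ∈ B, dist x y = setDist A B :=
  (hA'.image2 hB').csInf_mem (hA.image2 _ hB)

theorem GeodesicChoice.exists_isGeodesicSegment (lam : GeodesicChoice Z) (a b : Z) :
    ∃ γ : ℝ → Z, IsGeodesicSegment γ a b ∧ lam.carrier {a} {b} = γ '' Set.Icc 0 (dist a b) := by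
  have hi := lam.isometry {a} {b} (Set.finite_singleton a) (Set.singleton_nonempty a)
    (Set.finite_singleton b) (Set.singleton_nonempty b)
  have he := lam.endpoints {a} {b} (Set.finite_singleton a) (Set.singleton_nonempty a)
    (Set.finite_singleton b) (Set.singleton_nonempty b)
  rw [setDist_singleton] at hi he
  simp only [Set.mem_singleton_iff] at he
  rcases he with ⟨h0, h1⟩ | ⟨h0, h1⟩
  · exact ⟨_, ⟨h0, h1, hi⟩, by rw [GeodesicChoice.carrier, setDist_singleton]⟩
  · have hg : IsGeodesicSegment (lam.path {a} {b}) b a :=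
      ⟨h0, by rw [dist_comm, h1], by rw [dist_comm]; exact hi⟩
    refine ⟨_, hg.reverse, ?_⟩
    rw [GeodesicChoice.carrier, setDist_singleton, dist_comm b a]
    ext z
    constructor
    · rintro ⟨t, ht, rfl⟩
      exact ⟨dist a b - t, ⟨by linarith [ht.2], by linarith [ht.1]⟩, by simp⟩
    · rintro ⟨t, ht, rfl⟩
      exact ⟨dist a b - t, ⟨by linarith [ht.2], by linarith [ht.1]⟩, rfl⟩

theorem IsGeodesicSegment.dist_left {γ : ℝ → Z} {x y : Z} (h : IsGeodesicSegment γ x y) {t : ℝ}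
    (ht : t ∈ Set.Icc 0 (dist x y)) : dist x (γ t) = t := by
  have := h.2.2 0 ⟨le_rfl, dist_nonneg⟩ t ht
  rw [h.1] at this
  rw [this, zero_sub, abs_neg, abs_of_nonneg ht.1]

theorem IsGeodesicSegment.dist_right {γ : ℝ → Z} {x y : Z} (h : IsGeodesicSegment γ x y) {t : ℝ}
    (ht : t ∈ Set.Icc 0 (dist x y)) : dist (γ t) y = dist x y - t := by
  have := h.2.2 t ht (dist x y) ⟨dist_nonneg, le_rfl⟩
  rw [h.2.1] at this
  rw [this, abs_sub_comm, abs_of_nonneg (by linarith [ht.2])]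

/-- A point that almost realises the triangle equality is close to every geodesic. -/
theorem IsHyperbolicGeodesicSpace.exists_near {δ : ℝ} (hZ : IsHyperbolicGeodesicSpace δ Z)
    {γ : ℝ → Z} {a b : Z} (hγ : IsGeodesicSegment γ a b) {u : Z} {h : ℝ}
    (hu : dist a u + dist u b ≤ dist a b + h) :
    ∃ t ∈ Set.Icc 0 (dist a b), dist u (γ t) ≤ 2 * δ + h := by
  obtain ⟨β, hβ⟩ := hZ.exists_geodesic b u
  obtain ⟨α, hα⟩ := hZ.exists_geodesic a u
  -- The comparison point is as far from `a` as `u` is, or is `b` if `u` is farther away.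
  have ht : min (dist a u) (dist a b) ∈ Set.Icc 0 (dist a b) :=
    ⟨le_min dist_nonneg dist_nonneg, min_le_right _ _⟩
  refine ⟨_, ht, ?_⟩
  have h1 := hγ.dist_left ht
  have h2 := hγ.dist_right ht
  set t := min (dist a u) (dist a b) with ht_def
  have ht1 : t ≤ dist a u := min_le_left _ _
  have ht2 : dist a u - t ≤ h := by
    rcases le_total (dist a u) (dist a b) with h' | h'
    · rw [ht_def, min_eq_left h']
      linarith [dist_triangle a u b]
    · rw [ht_def, min_eq_right h']
      linarith [dist_nonneg (x := u) (y := b)]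
  rcases hZ.slim a b u γ β α hγ hβ hα t ht with ⟨s, hs, hd⟩ | ⟨s, hs, hd⟩
  · have h3 := hβ.dist_left hs
    have h4 := hβ.dist_right hs
    have h5 := dist_triangle (γ t) (β s) b
    have h6 := dist_triangle u (β s) (γ t)
    rw [dist_comm (β s) b] at h5
    rw [dist_comm u (β s), dist_comm (β s) (γ t)] at h6
    rw [dist_comm b u] at h4
    linarith
  · have h3 := hα.dist_left hs
    have h4 := hα.dist_right hs
    have h5 := dist_triangle a (α s) (γ t)
    have h6 := dist_triangle u (α s) (γ t)
    rw [dist_comm u (α s)] at h6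
    rw [dist_comm (α s) (γ t)] at h5 h6
    linarith

theorem dist_le_of_near_geodesic {γ : ℝ → Z} {a b : Z} (hγ : IsGeodesicSegment γ a b) {u v : Z}
    {r : ℝ} (hu : ∃ t ∈ Set.Icc 0 (dist a b), dist u (γ t) ≤ r)
    (hv : ∃ t ∈ Set.Icc 0 (dist a b), dist v (γ t) ≤ r) :
    dist u v ≤ |dist a u - dist a v| + 4 * r := by
  obtain ⟨s, hs, hs'⟩ := hu
  obtain ⟨t, ht, ht'⟩ := hv
  have h1 := hγ.dist_left hs
  have h2 := hγ.dist_left ht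
  have h3 := hγ.2.2 s hs t ht
  have h4 := dist_triangle a u (γ s)
  have h5 := dist_triangle a (γ s) u
  have h6 := dist_triangle a v (γ t)
  have h7 := dist_triangle a (γ t) v
  have h8 := dist_triangle4 u (γ s) (γ t) v
  rw [dist_comm (γ s) u] at h5
  rw [dist_comm (γ t) v] at h7 h8
  have h9 : |s - t| ≤ |dist a u - dist a v| + 2 * r := by
    rw [abs_le]
    constructor
    · linarith [neg_abs_le (dist a u - dist a v)]
    · linarith [le_abs_self (dist a u - dist a v)]
  linarith

/-- On `V`, the `1`-Lipschitz function `f` is an isometry to the line up to an additive error. -/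
structure IsCoarseCoordinate (f : Z → ℝ) (η : ℝ) (V : Set Z) : Prop where
  lipschitz : ∀ x y, f x - f y ≤ dist x y
  dist_le : ∀ x ∈ V, ∀ y ∈ V, dist x y ≤ |f x - f y| + η

theorem IsCoarseCoordinate.mono {f : Z → ℝ} {η : ℝ} {V W : Set Z} (h : IsCoarseCoordinate f η W)
    (hV : V ⊆ W) : IsCoarseCoordinate f η V :=
  ⟨h.lipschitz, fun x hx y hy => h.dist_le x (hV hx) y (hV hy)⟩

theorem isCoarseCoordinate_dist {γ : ℝ → Z} {a b : Z} (hγ : IsGeodesicSegment γ a b) {r : ℝ}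
    {V : Set Z} (hV : ∀ v ∈ V, ∃ t ∈ Set.Icc 0 (dist a b), dist v (γ t) ≤ r) :
    IsCoarseCoordinate (dist a) (4 * r) V where
  lipschitz x y := by linarith [dist_triangle a y x, dist_comm x y]
  dist_le x hx y hy := dist_le_of_near_geodesic hγ (hV x hx) (hV y hy)

end Distances

/-! ### Clusters and their order along a coarse coordinate. -/

section Clusters

variable {Z : Type*} [MetricSpace Z] {E : ℝ} {V C D : Set Z}

/-- Membership in `S` propagates along the edges of the proximity graph of `V`. -/
def IsProximityClosed (E : ℝ) (V S : Set Z) : Prop :=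
  ∀ u ∈ S, u ∈ V → ∀ x ∈ V, dist u x < E → x ∈ S

theorem IsCluster.subset (h : IsCluster E V C) : C ⊆ V := by
  obtain ⟨c, rfl⟩ := h
  rintro _ ⟨x, _, rfl⟩
  exact x.2

theorem IsCluster.nonempty (h : IsCluster E V C) : C.Nonempty := by
  obtain ⟨c, rfl⟩ := h
  exact c.nonempty_supp.image _

theorem IsCluster.isProximityClosed (h : IsCluster E V C) : IsProximityClosed E V C := by
  obtain ⟨c, rfl⟩ := h
  rintro _ ⟨u, hu, rfl⟩ _ x hx hd
  by_cases hux : u = ⟨x, hx⟩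
  · exact ⟨u, hu, by rw [hux]⟩
  · refine ⟨⟨x, hx⟩, ?_, rfl⟩
    exact c.mem_supp_congr_adj (show (proximityGraph E V).Adj u ⟨x, hx⟩ from ⟨hux, hd⟩) |>.1 hu

theorem IsCluster.subset_of_isProximityClosed (h : IsCluster E V C)
    (hD : IsProximityClosed E V D) {u : Z} (huC : u ∈ C) (huD : u ∈ D) : C ⊆ D := by
  obtain ⟨c, rfl⟩ := h
  obtain ⟨u, hu, rfl⟩ := huC
  rintro _ ⟨w, hw, rfl⟩
  have hr : (proximityGraph E V).Reachable u w := by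
    rw [SimpleGraph.ConnectedComponent.mem_supp_iff] at hu hw
    exact SimpleGraph.ConnectedComponent.exact (hu.trans hw.symm)
  obtain ⟨p⟩ := hr
  clear hu hw
  induction p with
  | nil => exact huD
  | cons hadj p ih => exact ih (hD _ huD (Subtype.prop _) _ (Subtype.prop _) hadj.2)

theorem IsCluster.eq_of_mem (hC : IsCluster E V C) (hD : IsCluster E V D) {u : Z} (huC : u ∈ C)
    (huD : u ∈ D) : C = D :=
  (hC.subset_of_isProximityClosed hD.isProximityClosed huC huD).antisymm
    (hD.subset_of_isProximityClosed hC.isProximityClosed huD huC)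

theorem exists_isCluster {v : Z} (hv : v ∈ V) : ∃ C, IsCluster E V C ∧ v ∈ C :=
  ⟨_, ⟨(proximityGraph E V).connectedComponentMk ⟨v, hv⟩, rfl⟩, ⟨v, hv⟩, rfl, rfl⟩

/-- A cluster is the smallest proximity-closed set through any of its points. This allows clusters
to be recognised without handling walks. -/
theorem isCluster_of_minimal (hCV : C ⊆ V) {u : Z} (hu : u ∈ C) (hcl : IsProximityClosed E V C)
    (hmin : ∀ D, IsProximityClosed E V D → u ∈ D → C ⊆ D) : IsCluster E V C := by
  obtain ⟨D, hD, huD⟩ := exists_isCluster (E := E) (hCV hu)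
  rwa [(hmin D hD.isProximityClosed huD).antisymm
    (hD.subset_of_isProximityClosed hcl huD hu)]

theorem IsCluster.le_dist (hC : IsCluster E V C) (hD : IsCluster E V D) (hne : C ≠ D) {u w : Z}
    (hu : u ∈ C) (hw : w ∈ D) : E ≤ dist u w := by
  by_contra! h
  exact hne (hC.eq_of_mem hD (hC.isProximityClosed u hu (hC.subset hu) w (hD.subset hw) h) hw)

/-- A cluster of `V` is a cluster of every set that agrees with `V` near the cluster. -/
theorem IsCluster.of_agree {V' : Set Z} (hC : IsCluster E V C) (h1 : C ⊆ V')
    (h2 : ∀ u ∈ C, ∀ x ∈ V', dist u x < E → x ∈ V) : IsCluster E V' C := by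
  obtain ⟨u, hu⟩ := hC.nonempty
  refine isCluster_of_minimal h1 hu (fun v hv _ x hx hd =>
    hC.isProximityClosed v hv (hC.subset hv) x (h2 v hv x hx hd) hd) fun D hD huD => ?_
  -- `D` is closed only in `V'`; its intersection with `C` is closed in `V`, where the minimality of
  -- `C` applies.
  refine (hC.subset_of_isProximityClosed (D := D ∩ C) ?_ hu ⟨huD, hu⟩).trans Set.inter_subset_left
  intro v hv hvV x hx hd
  have hxC := hC.isProximityClosed v hv.2 hvV x hx hd
  exact ⟨hD v hv.1 (h1 hv.2) x (h1 hxC) hd, hxC⟩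

variable {f : Z → ℝ} {η : ℝ}

theorem IsCoarseCoordinate.le_abs_sub (hf : IsCoarseCoordinate f η V) (hC : IsCluster E V C)
    (hD : IsCluster E V D) (hne : C ≠ D) {u w : Z} (hu : u ∈ C) (hw : w ∈ D) :
    E - η ≤ |f u - f w| := by
  linarith [hf.dist_le u (hC.subset hu) w (hD.subset hw), hC.le_dist hD hne hu hw]

/-- An edge of the proximity graph changes `f` by less than `E`, while stepping over `f w` inside
`C` would change it by at least `2 (E - η)`. -/
theorem IsCoarseCoordinate.isProximityClosed_Iio (hf : IsCoarseCoordinate f η V) (hE : 3 * η < E)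
    (hC : IsCluster E V C) (hD : IsCluster E V D) (hne : C ≠ D) {w : Z} (hw : w ∈ D) :
    IsProximityClosed E V {v | v ∈ C ∧ f v < f w} := by
  rintro u ⟨huC, hu⟩ huV x hx hd
  have hxC := hC.isProximityClosed u huC huV x hx hd
  refine ⟨hxC, ?_⟩
  by_contra! h
  have h1 := hf.le_abs_sub hC hD hne huC hw
  have h2 := hf.le_abs_sub hC hD hne hxC hw
  -- Taking both points equal yields `0 ≤ η`.
  have h3 := hf.dist_le w (hD.subset hw) w (hD.subset hw)
  have h4 := hf.lipschitz x u
  rw [dist_comm] at h4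
  rw [abs_of_neg (by linarith)] at h1
  rw [abs_of_nonneg (by linarith)] at h2
  simp at h3
  linarith

/-- Connectedness keeps `C` on one side of each point of `D`, and `D` on one side of each point of
`C`, so the side is the same for all pairs. -/
theorem IsCoarseCoordinate.lt_or_gt (hf : IsCoarseCoordinate f η V) (hE : 3 * η < E)
    (hC : IsCluster E V C) (hD : IsCluster E V D) (hne : C ≠ D) :
    (∀ u ∈ C, ∀ w ∈ D, f u < f w) ∨ (∀ u ∈ C, ∀ w ∈ D, f w < f u) := by
  have key : ∀ {C D : Set Z}, IsCluster E V C → IsCluster E V D → C ≠ D →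
      ∀ w ∈ D, ∀ u ∈ C, f u < f w → ∀ v ∈ C, f v < f w := by
    intro C D hC hD hne w hw u hu huw v hv
    exact (hC.subset_of_isProximityClosed (hf.isProximityClosed_Iio hE hC hD hne hw) hu
      ⟨hu, huw⟩ hv).2
  have hneq : ∀ u ∈ C, ∀ w ∈ D, f u ≠ f w := by
    intro u hu w hw h
    have h1 := hf.le_abs_sub hC hD hne hu hw
    have h3 := hf.dist_le w (hD.subset hw) w (hD.subset hw)
    simp [h] at h1 h3
    linarith
  obtain ⟨u, hu⟩ := hC.nonempty
  obtain ⟨w, hw⟩ := hD.nonempty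
  rcases lt_or_gt_of_ne (hneq u hu w hw) with h | h
  · left
    intro u' hu' w' hw'
    refine key hC hD hne w' hw' u hu ?_ u' hu'
    by_contra! h'
    have := key hD hC hne.symm u hu w' hw' (lt_of_le_of_ne h' (hneq u hu w' hw').symm) w hw
    linarith
  · right
    intro u' hu' w' hw'
    refine key hD hC hne.symm u' hu' w hw ?_ w' hw'
    by_contra! h'
    have := key hC hD hne w hw u' hu' (lt_of_le_of_ne h' (hneq u' hu' w hw)) u hu
    linarith

end Clusters

/-! ### Finite linear orders and path graphs. -/

section Paths

theorem exists_equiv_fin_strictMono {X : Type*} [Finite X] [Nonempty X] {g : X → ℝ}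
    (hg : Function.Injective g) : ∃ (n : ℕ) (e : Fin (n + 1) ≃ X), StrictMono (g ∘ e) := by
  have := Fintype.ofFinite X
  let _ : LinearOrder X := LinearOrder.lift' g hg
  obtain ⟨n, hn⟩ := Nat.exists_eq_succ_of_ne_zero (Fintype.card_ne_zero (α := X))
  refine ⟨n, (monoEquivOfFin X hn).toEquiv, fun i j hij => ?_⟩
  exact (monoEquivOfFin X hn).strictMono hij

/-- A path is rigid once its first vertex is fixed: the image of `k + 1` is a neighbour of `k`, and
injectivity excludes `k - 1`. -/
theorem pathGraph_iso_val {n m : ℕ}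
    (σ : SimpleGraph.pathGraph (n + 1) ≃g SimpleGraph.pathGraph (m + 1)) (h0 : σ 0 = 0) :
    ∀ k : ℕ, ∀ hk : k < n + 1, (σ ⟨k, hk⟩).val = k := by
  intro k
  induction k using Nat.strong_induction_on with
  | _ k ih =>
    intro hk
    rcases k with _ | k
    · simpa using congrArg Fin.val h0
    · have hadj : (SimpleGraph.pathGraph (n + 1)).Adj ⟨k, by omega⟩ ⟨k + 1, hk⟩ := by
        rw [SimpleGraph.pathGraph_adj]
        exact Or.inl rfl
      have hadj' := σ.map_rel_iff.2 hadj
      have hk1 := ih k (by omega) (by omega)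
      rw [SimpleGraph.pathGraph_adj] at hadj'
      rcases hadj' with h | h
      · exact h.symm.trans (congrArg (· + 1) hk1)
      · rcases k with _ | k
        · have : (σ ⟨0, by omega⟩).val = 0 := hk1
          have h' : (σ ⟨0 + 1, hk⟩).val + 1 = (σ ⟨0, by omega⟩).val := h
          omega
        · have hk2 := ih k (by omega) (by omega)
          have h' : (σ ⟨k + 1 + 1, hk⟩).val + 1 = (σ ⟨k + 1, by omega⟩).val := h
          have heq : σ ⟨k + 1 + 1, hk⟩ = σ ⟨k, by omega⟩ := by
            apply Fin.ext
            omega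
          have := congrArg Fin.val (σ.injective heq)
          simp only at this
          omega

end Paths

section Vertices

variable {Z : Type*}

theorem vertexSet_finite (a b : Z) (Y : Finset Z) : (vertexSet a b Y).Finite :=
  Y.finite_toSet.union (by simp)

theorem left_mem_vertexSet (a b : Z) (Y : Finset Z) : a ∈ vertexSet a b Y := by
  simp [vertexSet]

theorem right_mem_vertexSet (a b : Z) (Y : Finset Z) : b ∈ vertexSet a b Y := by
  simp [vertexSet]

end Vertices

/-! ### Which clusters separate which. -/

section Separation

variable {Z : Type*} [MetricSpace Z] {δ E η ε' : ℝ} {V C C' D : Set Z} {f : Z → ℝ}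

/-- A point of `D` has `f`-value between those of the ends `x`, `y` of a minimal geodesic, so the
detour through it costs at most `2η`. Slimness brings it within `2δ + 2η` of the geodesic. -/
theorem separates_of_between (hZ : IsHyperbolicGeodesicSpace δ Z) (hf : IsCoarseCoordinate f η V)
    (hV : V.Finite) (hε' : 2 * δ + 2 * η ≤ 4 * ε') (hC : IsCluster E V C) (hC' : IsCluster E V C')
    (hD : IsCluster E V D) (h1 : ∀ u ∈ C, ∀ w ∈ D, f u < f w) (h2 : ∀ u ∈ D, ∀ w ∈ C', f u < f w) :
    Separates (2 * ε') D C C' := by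
  obtain ⟨x, hx, y, hy, hxy⟩ := exists_dist_eq_setDist (hV.subset hC.subset) (hV.subset hC'.subset)
    hC.nonempty hC'.nonempty
  obtain ⟨w, hw⟩ := hD.nonempty
  obtain ⟨γ, hγ⟩ := hZ.exists_geodesic x y
  have h3 := hf.dist_le x (hC.subset hx) w (hD.subset hw)
  have h4 := hf.dist_le w (hD.subset hw) y (hC'.subset hy)
  have h5 := hf.lipschitz y x
  rw [abs_of_neg (by linarith [h1 x hx w hw])] at h3
  rw [abs_of_neg (by linarith [h2 w hw y hy])] at h4
  rw [dist_comm] at h5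
  obtain ⟨t, ht, htd⟩ := hZ.exists_near hγ (u := w) (h := 2 * η) (by linarith)
  refine ⟨x, hx, y, hy, hxy, γ, hγ, t, ht, w, hw, ?_⟩
  rw [dist_comm]
  linarith

/-- Along a minimal geodesic from `C` to `C'` the function `f` never drops more than `η` below its
initial value, while `D` lies at least `E - η` below that value. -/
theorem not_separates_of_lt (hf : IsCoarseCoordinate f η V) (hε' : 4 * ε' < E - 2 * η)
    (hC : IsCluster E V C) (hC' : IsCluster E V C')
    (hD : IsCluster E V D) (hDC : D ≠ C) (h1 : ∀ u ∈ D, ∀ w ∈ C, f u < f w)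
    (h2 : ∀ u ∈ C, ∀ w ∈ C', f u < f w) :
    ¬ Separates (2 * ε') D C C' := by
  rintro ⟨x, hx, y, hy, hxy, γ, hγ, t, ht, w, hw, htw⟩
  have h3 := hf.le_abs_sub hD hC hDC hw hx
  have h4 := hf.dist_le x (hC.subset hx) y (hC'.subset hy)
  rw [abs_of_neg (by linarith [h1 w hw x hx])] at h3
  rw [abs_of_neg (by linarith [h2 x hx y hy])] at h4
  have h5 := hγ.dist_right ht
  have h6 := hf.lipschitz (γ t) w
  have h7 := hf.lipschitz y (γ t)
  rw [dist_comm] at h7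
  linarith [ht.1]

theorem not_separates_of_gt (hf : IsCoarseCoordinate f η V) (hε' : 4 * ε' < E - 2 * η)
    (hC : IsCluster E V C) (hC' : IsCluster E V C')
    (hD : IsCluster E V D) (hDC : D ≠ C') (h1 : ∀ u ∈ C', ∀ w ∈ D, f u < f w)
    (h2 : ∀ u ∈ C, ∀ w ∈ C', f u < f w) :
    ¬ Separates (2 * ε') D C C' := by
  rintro ⟨x, hx, y, hy, hxy, γ, hγ, t, ht, w, hw, htw⟩
  have h3 := hf.le_abs_sub hD hC' hDC hw hy
  have h4 := hf.dist_le x (hC.subset hx) y (hC'.subset hy)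
  rw [abs_of_pos (by linarith [h1 y hy w hw])] at h3
  rw [abs_of_neg (by linarith [h2 x hx y hy])] at h4
  have h5 := hγ.dist_left ht
  have h6 := hf.lipschitz w (γ t)
  have h7 := hf.lipschitz (γ t) x
  rw [dist_comm] at h6 h7
  linarith [ht.2]

end Separation

/-! ### The separation graph is a path, in a unique way. -/

namespace ClusterOrder

variable {Z : Type*} [MetricSpace Z] {δ E η ε' : ℝ} {a b : Z} {Y : Finset Z} {f : Z → ℝ}

/-- The clusters are listed in the order of their values under `f`. -/
def IsOrderedBy (O : ClusterOrder E ε' a b Y) (f : Z → ℝ) : Prop :=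
  ∀ i j, i < j → ∀ u ∈ O.cluster i, ∀ w ∈ O.cluster j, f u < f w

theorem isCluster (O : ClusterOrder E ε' a b Y) (i : Fin (O.n + 1)) :
    IsCluster E (vertexSet a b Y) (O.cluster i) := (O.iso i).2

theorem cluster_injective (O : ClusterOrder E ε' a b Y) : Function.Injective O.cluster :=
  Subtype.val_injective.comp O.iso.injective

theorem exists_cluster_eq (O : ClusterOrder E ε' a b Y) {C : Set Z}
    (hC : IsCluster E (vertexSet a b Y) C) : ∃ i, O.cluster i = C := by
  obtain ⟨i, hi⟩ := O.iso.surjective ⟨C, hC⟩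
  exact ⟨i, congrArg Subtype.val hi⟩

theorem exists_mem_cluster (O : ClusterOrder E ε' a b Y) {v : Z} (hv : v ∈ vertexSet a b Y) :
    ∃ i, v ∈ O.cluster i := by
  obtain ⟨C, hC, hvC⟩ := exists_isCluster (E := E) hv
  obtain ⟨i, rfl⟩ := O.exists_cluster_eq hC
  exact ⟨i, hvC⟩

theorem eq_of_mem_cluster (O : ClusterOrder E ε' a b Y) {v : Z} {i j : Fin (O.n + 1)}
    (hi : v ∈ O.cluster i) (hj : v ∈ O.cluster j) : i = j :=
  O.cluster_injective ((O.isCluster i).eq_of_mem (O.isCluster j) hi hj)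

/-- Sorting the clusters by `f` makes adjacency mean consecutive. The point `b` need not maximise
`f`: clusters are at least `E - η` apart, so being that close to the maximum puts it in the last
one. -/
theorem exists_isOrderedBy (hZ : IsHyperbolicGeodesicSpace δ Z)
    (hf : IsCoarseCoordinate f η (vertexSet a b Y)) (hε' : 2 * δ + 2 * η ≤ 4 * ε')
    (hE : 3 * η < E) (hE' : 4 * ε' < E - 2 * η) (ha : ∀ v ∈ vertexSet a b Y, f a ≤ f v)
    (hb : ∀ v ∈ vertexSet a b Y, f v < f b + E - η) :
    ∃ O : ClusterOrder E ε' a b Y, O.IsOrderedBy f := by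
  set V := vertexSet a b Y with hV
  have hVf : V.Finite := vertexSet_finite a b Y
  have hfin : Finite {C : Set Z // IsCluster E V C} :=
    Set.Finite.subset hVf.finite_subsets fun C hC => IsCluster.subset hC
  have hne : Nonempty {C : Set Z // IsCluster E V C} := by
    obtain ⟨C, hC, _⟩ := exists_isCluster (E := E) (left_mem_vertexSet a b Y)
    exact ⟨⟨C, hC⟩⟩
  -- Any representative will do, because the `f`-ranges of clusters do not interleave.
  let g : {C : Set Z // IsCluster E V C} → ℝ := fun C => f C.2.nonempty.some
  have hg : Function.Injective g := by
    intro C D h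
    by_contra hCD
    rcases hf.lt_or_gt hE C.2 D.2 (fun h => hCD (Subtype.ext h)) with h' | h'
    · exact (h' _ C.2.nonempty.some_mem _ D.2.nonempty.some_mem).ne h
    · exact (h' _ C.2.nonempty.some_mem _ D.2.nonempty.some_mem).ne' h
  obtain ⟨n, e, he⟩ := exists_equiv_fin_strictMono hg
  have hval : ∀ {i j}, i ≠ j → (e i).1 ≠ (e j).1 := fun h h' =>
    h (e.injective (Subtype.ext h'))
  have hord : ∀ i j, i < j → ∀ u ∈ (e i).1, ∀ w ∈ (e j).1, f u < f w := by
    intro i j hij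
    rcases hf.lt_or_gt hE (e i).2 (e j).2 (hval hij.ne) with h | h
    · exact h
    · exact absurd (he hij)
        (h _ (e i).2.nonempty.some_mem _ (e j).2.nonempty.some_mem).not_gt
  have hadj : ∀ i j, i < j → ((separationGraph E ε' V).Adj (e i) (e j) ↔ i.val + 1 = j.val) := by
    intro i j hij
    constructor
    · rintro ⟨_, h⟩
      by_contra hne
      have hlt : i.val + 1 < j.val := by
        have := Fin.lt_def.1 hij
        omega
      let k : Fin (n + 1) := ⟨i.val + 1, by omega⟩
      have hik : i < k := Fin.lt_def.2 (Nat.lt_succ_self _)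
      have hkj : k < j := Fin.lt_def.2 hlt
      exact h (e k) (fun h => hik.ne' (e.injective h)) (fun h => hkj.ne (e.injective h))
        (separates_of_between hZ hf hVf hε' (e i).2 (e j).2 (e k).2 (hord i k hik) (hord k j hkj))
    · intro h
      refine ⟨fun h => hij.ne (e.injective h), fun D hD1 hD2 => ?_⟩
      obtain ⟨k, rfl⟩ := e.surjective D
      have hki : k ≠ i := fun h => hD1 (by rw [h])
      have hkj : k ≠ j := fun h => hD2 (by rw [h])
      rcases lt_or_gt_of_ne hki with h' | h'
      · exact not_separates_of_lt hf hE' (e i).2 (e j).2 (e k).2 (hval hki) (hord k i h')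
          (hord i j hij)
      · rcases lt_or_gt_of_ne hkj with h'' | h''
        · exfalso
          have := Fin.lt_def.1 h'
          have := Fin.lt_def.1 h''
          omega
        · exact not_separates_of_gt hf hE' (e i).2 (e j).2 (e k).2 (hval hkj) (hord j k h'')
            (hord i j hij)
  have hiso : ∀ i j, (separationGraph E ε' V).Adj (e i) (e j) ↔
      (SimpleGraph.pathGraph (n + 1)).Adj i j := by
    intro i j
    rw [SimpleGraph.pathGraph_adj]
    rcases lt_trichotomy i j with h | h | h
    · rw [hadj i j h]
      have := Fin.lt_def.1 h
      omega
    · subst h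
      simp
    · rw [SimpleGraph.adj_comm, hadj j i h]
      have := Fin.lt_def.1 h
      omega
  obtain ⟨Ca, hCa, haC⟩ := exists_isCluster (E := E) (left_mem_vertexSet a b Y)
  obtain ⟨Cb, hCb, hbC⟩ := exists_isCluster (E := E) (right_mem_vertexSet a b Y)
  obtain ⟨i, hi⟩ := e.surjective ⟨Ca, hCa⟩
  obtain ⟨j, hj⟩ := e.surjective ⟨Cb, hCb⟩
  have hi' : (e i).1 = Ca := congrArg Subtype.val hi
  have hj' : (e j).1 = Cb := congrArg Subtype.val hj
  have hi0 : i = 0 := by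
    by_contra h
    obtain ⟨w, hw⟩ := (e 0).2.nonempty
    have := hord 0 i (Fin.pos_of_ne_zero h) w hw a (hi' ▸ haC)
    linarith [ha w ((e 0).2.subset hw)]
  have hjn : j = Fin.last n := by
    by_contra h
    obtain ⟨w, hw⟩ := (e (Fin.last n)).2.nonempty
    have h1 := hord j (Fin.last n) (Fin.lt_last_iff_ne_last.2 h) b (hj' ▸ hbC) w hw
    have h2 := hf.le_abs_sub (e j).2 (e (Fin.last n)).2 (hval h) (hj' ▸ hbC) hw
    rw [abs_of_neg (by linarith)] at h2
    linarith [hb w ((e (Fin.last n)).2.subset hw)]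
  subst hi0 hjn
  exact ⟨⟨n, ⟨e, fun {i j} => hiso i j⟩, hi' ▸ haC, hj' ▸ hbC⟩, hord⟩

/-- Two orders of the same clusters differ by an isomorphism of paths that fixes the vertex `0`,
since both start at the cluster of `a`. -/
theorem IsOrderedBy.congr {O O' : ClusterOrder E ε' a b Y} (hO : O.IsOrderedBy f) :
    O'.IsOrderedBy f := by
  have h0 : O.iso.symm (O'.iso 0) = 0 := by
    rw [← O.iso.injective.eq_iff, RelIso.apply_symm_apply]
    exact Subtype.ext ((O'.iso 0).2.eq_of_mem (O.iso 0).2 O'.a_mem O.a_mem)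
  have hval := pathGraph_iso_val (O'.iso.trans O.iso.symm) h0
  have hcl : ∀ i : Fin (O'.n + 1), O.cluster (O.iso.symm (O'.iso i)) = O'.cluster i := by
    intro i
    simp [cluster]
  intro i j hij
  rw [← hcl i, ← hcl j]
  refine hO _ _ ?_
  rw [Fin.lt_def] at hij ⊢
  have h1 := hval i.val i.2
  have h2 := hval j.val j.2
  simp only [RelIso.trans_apply, Fin.eta] at h1 h2
  rwa [h1, h2]

end ClusterOrder

/-- The segments `[base i, base i + len i]`, shortened by `r₁` at both ends; the segments of length
at most `2 r₁ + r₂` are discarded. -/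
def trimmedSeg {n : ℕ} (base : Fin n → ℝ) (len : Fin n → ℕ) (r₁ r₂ : ℕ) (i : Fin n) : Set ℝ :=
  if 2 * r₁ + r₂ < len i then Set.Icc (base i + r₁) (base i + len i - r₁) else ∅

theorem trimmedSeg_subset {n : ℕ} (base : Fin n → ℝ) (len : Fin n → ℕ) (r₁ r₂ : ℕ) (i : Fin n) :
    trimmedSeg base len r₁ r₂ i ⊆ Set.Icc (base i) (base i + len i) := by
  unfold trimmedSeg
  split_ifs
  · exact Set.Icc_subset_Icc (by simp) (by simp)
  · exact Set.empty_subset _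

theorem ordConnected_trimmedSeg {n : ℕ} (base : Fin n → ℝ) (len : Fin n → ℕ) (r₁ r₂ : ℕ)
    (i : Fin n) : (trimmedSeg base len r₁ r₂ i).OrdConnected := by
  unfold trimmedSeg
  split_ifs
  · exact Set.ordConnected_Icc
  · exact Set.ordConnected_empty

/-! ### The stable interval and its thickenings. -/

namespace ClusterOrder

variable {Z : Type*} [MetricSpace Z] {E ε' : ℝ} {a b : Z} {Y : Finset Z}
  (lam : GeodesicChoice Z) (O : ClusterOrder E ε' a b Y)

/-- The length of an edge component, as a natural number. -/
def edgeLen (i : Fin O.n) : ℕ := ⌊setDist (O.cluster i.castSucc) (O.cluster i.succ)⌋₊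

theorem edgeLength_eq (i : Fin O.n) : O.edgeLength i = O.edgeLen i :=
  (natCast_floor_eq_intCast_floor (setDist_nonneg _ _)).symm

theorem edgeHi_eq (i : Fin O.n) : O.edgeHi lam i = O.edgeLo lam i + O.edgeLen i := by
  rw [edgeHi, edgeLength_eq]

theorem clusterLength_nonneg (i : Fin (O.n + 1)) : 0 ≤ O.clusterLength lam i := Metric.diam_nonneg

theorem edgeLength_nonneg (i : Fin O.n) : 0 ≤ O.edgeLength i := by
  rw [edgeLength_eq]
  positivity

theorem clusterLo_nonneg (i : Fin (O.n + 1)) : 0 ≤ O.clusterLo lam i :=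
  Finset.sum_nonneg fun _ _ => add_nonneg (O.clusterLength_nonneg lam _) (O.edgeLength_nonneg _)

theorem clusterLo_le_clusterHi (i : Fin (O.n + 1)) : O.clusterLo lam i ≤ O.clusterHi lam i :=
  le_add_of_nonneg_right (O.clusterLength_nonneg lam i)

theorem edgeLo_le_edgeHi (i : Fin O.n) : O.edgeLo lam i ≤ O.edgeHi lam i :=
  le_add_of_nonneg_right (O.edgeLength_nonneg i)

theorem edgeHi_le_clusterLo {i : Fin O.n} {j : Fin (O.n + 1)} (h : i.castSucc < j) :
    O.edgeHi lam i ≤ O.clusterLo lam j := by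
  have hi : O.edgeHi lam i = ∑ k ∈ insert i (Finset.univ.filter
      fun k : Fin O.n => k.castSucc < i.castSucc),
        (O.clusterLength lam k.castSucc + O.edgeLength k) := by
    rw [Finset.sum_insert (by simp)]
    simp only [edgeHi, edgeLo, clusterHi, clusterLo]
    ring
  rw [hi]
  refine Finset.sum_le_sum_of_subset_of_nonneg ?_ fun k _ _ =>
    add_nonneg (O.clusterLength_nonneg lam _) (O.edgeLength_nonneg _)
  intro k hk
  rcases Finset.mem_insert.1 hk with rfl | hk
  · simpa using h
  · simp only [Finset.mem_filter, Finset.mem_univ, true_and] at hk ⊢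
    exact hk.trans h

theorem clusterHi_mono {i j : Fin (O.n + 1)} (h : i ≤ j) :
    O.clusterHi lam i ≤ O.clusterHi lam j := by
  rcases h.eq_or_lt with rfl | h
  · exact le_rfl
  · obtain ⟨k, rfl⟩ := Fin.exists_castSucc_eq.2 (h.trans_le (Fin.le_last j)).ne
    exact (O.edgeLo_le_edgeHi lam k).trans
      ((O.edgeHi_le_clusterLo lam h).trans (O.clusterLo_le_clusterHi lam j))

theorem clusterHi_le_edgeLo {i : Fin (O.n + 1)} {j : Fin O.n} (h : i ≤ j.castSucc) :
    O.clusterHi lam i ≤ O.edgeLo lam j :=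
  O.clusterHi_mono lam h

theorem edgeHi_le_edgeLo {i j : Fin O.n} (h : i < j) : O.edgeHi lam i ≤ O.edgeLo lam j :=
  (O.edgeHi_le_clusterLo lam (Fin.castSucc_lt_castSucc_iff.2 h)).trans
    (O.clusterLo_le_clusterHi lam _)

theorem edgeHi_eq_clusterLo (i : Fin O.n) : O.edgeHi lam i = O.clusterLo lam i.succ := by
  have : (Finset.univ.filter fun k : Fin O.n => k.castSucc < i.succ) =
      insert i (Finset.univ.filter fun k : Fin O.n => k.castSucc < i.castSucc) := by
    ext k
    simp only [Finset.mem_filter, Finset.mem_univ, true_and, Finset.mem_insert, Fin.lt_def,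
      Fin.ext_iff, Fin.val_castSucc, Fin.val_succ]
    omega
  rw [clusterLo, this, Finset.sum_insert (by simp)]
  simp only [edgeHi, edgeLo, clusterHi, clusterLo]
  ring

theorem clusterSeg_subset_interval (i : Fin (O.n + 1)) : O.clusterSeg lam i ⊆ O.interval lam :=
  Set.Icc_subset_Icc (O.clusterLo_nonneg lam i) (O.clusterHi_mono lam (Fin.le_last i))

theorem edgeSeg_subset_interval (i : Fin O.n) : O.edgeSeg lam i ⊆ O.interval lam :=
  Set.Icc_subset_Icc ((O.clusterLo_nonneg lam i.castSucc).trans (O.clusterLo_le_clusterHi lam _))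
    ((O.edgeHi_le_clusterLo lam (Fin.castSucc_lt_succ)).trans
      ((O.clusterLo_le_clusterHi lam _).trans (O.clusterHi_mono lam (Fin.le_last _))))

/-- This makes the unthickened edge part the case `r₁ = r₂ = 0` of one construction. Positive
lengths are needed because `trimmedSeg` discards degenerate segments. -/
theorem edgeSeg_eq_trimmedSeg (h : ∀ i, 0 < O.edgeLen i) :
    O.edgeSeg lam = trimmedSeg (O.edgeLo lam) O.edgeLen 0 0 := by
  funext i
  simp [trimmedSeg, h i, edgeSeg, edgeHi_eq]

theorem lt_of_mem_nbhdIn {r : ℝ} {i : Fin (O.n + 1)} {j : Fin O.n} (h : i ≤ j.castSucc) {x : ℝ}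
    (hx : x ∈ nbhdIn (O.interval lam) r (O.clusterSeg lam i)) : x < O.edgeLo lam j + r := by
  obtain ⟨w, hw, hxw⟩ := (Metric.infDist_lt_iff
    (Set.nonempty_Icc.2 (O.clusterLo_le_clusterHi lam i))).1 hx.2
  have := O.clusterHi_le_edgeLo lam h
  have h1 := (abs_lt.1 (by rwa [Real.dist_eq] at hxw)).2
  linarith [hw.2]

theorem gt_of_mem_nbhdIn {r : ℝ} {i : Fin (O.n + 1)} {j : Fin O.n} (h : j.castSucc < i) {x : ℝ}
    (hx : x ∈ nbhdIn (O.interval lam) r (O.clusterSeg lam i)) : O.edgeHi lam j - r < x := by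
  obtain ⟨w, hw, hxw⟩ := (Metric.infDist_lt_iff
    (Set.nonempty_Icc.2 (O.clusterLo_le_clusterHi lam i))).1 hx.2
  have := O.edgeHi_le_clusterLo lam h
  have h1 := (abs_lt.1 (by rwa [Real.dist_eq] at hxw)).1
  linarith [hw.1]

theorem mem_nbhdIn_castSucc {r : ℝ} {i : Fin O.n} {x : ℝ} (hx : x ∈ O.edgeSeg lam i)
    (h : x < O.edgeLo lam i + r) :
    x ∈ nbhdIn (O.interval lam) r (O.clusterSeg lam i.castSucc) := by
  refine ⟨O.edgeSeg_subset_interval lam i hx, (Metric.infDist_le_dist_of_mem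
    (Set.right_mem_Icc.2 (O.clusterLo_le_clusterHi lam i.castSucc))).trans_lt ?_⟩
  change dist x (O.edgeLo lam i) < r
  rw [Real.dist_eq, abs_of_nonneg (by linarith [hx.1])]
  linarith

theorem mem_nbhdIn_succ {r : ℝ} {i : Fin O.n} {x : ℝ} (hx : x ∈ O.edgeSeg lam i)
    (h : O.edgeHi lam i - r < x) :
    x ∈ nbhdIn (O.interval lam) r (O.clusterSeg lam i.succ) := by
  refine ⟨O.edgeSeg_subset_interval lam i hx, (Metric.infDist_le_dist_of_mem
    (Set.left_mem_Icc.2 (O.clusterLo_le_clusterHi lam i.succ))).trans_lt ?_⟩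
  rw [← O.edgeHi_eq_clusterLo, Real.dist_eq, abs_of_nonpos (by linarith [hx.2])]
  linarith

/-- The neighbourhoods of the two adjacent cluster components meet or come within `r₂`, so their
hull swallows the whole edge. -/
theorem mem_thickCluster_of_edgeLen_le {r₁ r₂ : ℕ} (hr : 0 < r₁) {i : Fin O.n}
    (h : O.edgeLen i ≤ 2 * r₁ + r₂) {x : ℝ} (hx : x ∈ O.edgeSeg lam i) :
    x ∈ thickCluster (O.interval lam) (O.clusterSeg lam) r₁ r₂ := by
  have hr' : (0 : ℝ) < r₁ := by exact_mod_cast hr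
  have hle : (O.edgeLen i : ℝ) ≤ 2 * r₁ + r₂ := by exact_mod_cast h
  have hEq := O.edgeHi_eq lam i
  have hlh := O.edgeLo_le_edgeHi lam i
  have hlo : O.edgeLo lam i ∈ O.edgeSeg lam i := ⟨le_rfl, hlh⟩
  have hhi : O.edgeHi lam i ∈ O.edgeSeg lam i := ⟨hlh, le_rfl⟩
  simp only [thickCluster, Set.mem_iUnion]
  refine ⟨i.castSucc, i.succ, ?_, ?_⟩
  · rcases lt_or_ge (O.edgeLen i : ℝ) (2 * r₁) with h2 | h2
    · have hm : (O.edgeLo lam i + O.edgeHi lam i) / 2 ∈ O.edgeSeg lam i :=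
        ⟨by linarith, by linarith⟩
      refine (setDist_le_dist (O.mem_nbhdIn_castSucc lam hm (by linarith))
        (O.mem_nbhdIn_succ lam hm (by linarith))).trans ?_
      simp
    -- The neighbourhoods are open, so their distance `len - 2 r₁` is only approached, by points at
    -- depth `d` inside each.
    · refine le_of_forall_pos_le_add fun e he => ?_
      set d := min (e / 2) r₁ with hd
      have hd1 : d ≤ e / 2 := min_le_left _ _
      have hd2 : d ≤ r₁ := min_le_right _ _
      have hd0 : 0 < d := lt_min (by linarith) hr'
      have h3 : O.edgeLo lam i + r₁ - d ∈ O.edgeSeg lam i := ⟨by linarith, by linarith⟩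
      have h4 : O.edgeHi lam i - r₁ + d ∈ O.edgeSeg lam i := ⟨by linarith, by linarith⟩
      refine (setDist_le_dist (O.mem_nbhdIn_castSucc lam h3 (by linarith))
        (O.mem_nbhdIn_succ lam h4 (by linarith))).trans ?_
      rw [Real.dist_eq, abs_le]
      constructor <;> linarith [show (0:ℝ) ≤ r₂ by positivity]
  · have hc := convex_convexHull ℝ (nbhdIn (O.interval lam) r₁ (O.clusterSeg lam i.castSucc) ∪
      nbhdIn (O.interval lam) r₁ (O.clusterSeg lam i.succ))
    exact hc.ordConnected.out
      (subset_convexHull ℝ _ (Or.inl (O.mem_nbhdIn_castSucc lam hlo (by linarith))))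
      (subset_convexHull ℝ _ (Or.inr (O.mem_nbhdIn_succ lam hhi (by linarith)))) hx

/-- Neighbourhoods of clusters on the left stay below `edgeLo + r₁` and those on the right above
`edgeHi - r₁`. The two sides are more than `r₂` apart, so no hull crosses the middle. -/
theorem mem_thickCluster_iff {r₁ r₂ : ℕ} {i : Fin O.n}
    (h : 2 * r₁ + r₂ < O.edgeLen i) {x : ℝ} (hx : x ∈ O.edgeSeg lam i) :
    x ∈ thickCluster (O.interval lam) (O.clusterSeg lam) r₁ r₂ ↔
      x < O.edgeLo lam i + r₁ ∨ O.edgeHi lam i - r₁ < x := by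
  have hlt : (2 : ℝ) * r₁ + r₂ < O.edgeLen i := by exact_mod_cast h
  have hEq := O.edgeHi_eq lam i
  constructor
  · intro hxc
    by_contra! hx'
    simp only [thickCluster, Set.mem_iUnion] at hxc
    obtain ⟨j, k, hjk, hxc⟩ := hxc
    have hleft : ∀ j ≤ i.castSucc, nbhdIn (O.interval lam) r₁ (O.clusterSeg lam j) ⊆
        Set.Iio (O.edgeLo lam i + r₁) := fun j hj z hz => O.lt_of_mem_nbhdIn lam hj hz
    have hright : ∀ j, i.castSucc < j → nbhdIn (O.interval lam) r₁ (O.clusterSeg lam j) ⊆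
        Set.Ioi (O.edgeHi lam i - r₁) := fun j hj z hz => O.gt_of_mem_nbhdIn lam hj hz
    -- For `r₁ = 0` all the neighbourhoods are empty, and a lower bound on `setDist` is not
    -- available.
    have hne : (nbhdIn (O.interval lam) r₁ (O.clusterSeg lam j)).Nonempty ∧
        (nbhdIn (O.interval lam) r₁ (O.clusterSeg lam k)).Nonempty ∨ r₁ = 0 := by
      rcases Nat.eq_zero_or_pos r₁ with h0 | h0
      · exact Or.inr h0
      · have h0' : (0 : ℝ) < r₁ := by exact_mod_cast h0
        have hn : ∀ j, (nbhdIn (O.interval lam) r₁ (O.clusterSeg lam j)).Nonempty := fun j =>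
          have hm := Set.left_mem_Icc.2 (O.clusterLo_le_clusterHi lam j)
          ⟨_, O.clusterSeg_subset_interval lam j hm,
            by rwa [Metric.infDist_zero_of_mem (show _ ∈ O.clusterSeg lam j from hm)]⟩
        exact Or.inl ⟨hn j, hn k⟩
    have hsep : ∀ y ∈ Set.Iio (O.edgeLo lam i + r₁), ∀ z ∈ Set.Ioi (O.edgeHi lam i - r₁),
        (O.edgeLen i : ℝ) - 2 * r₁ ≤ dist y z := by
      intro y hy z hz
      rw [Set.mem_Iio] at hy
      rw [Set.mem_Ioi] at hz
      rw [dist_comm]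
      exact le_trans (by linarith) (le_abs_self _)
    rcases hne with ⟨hnj, hnk⟩ | h0
    · rcases le_or_gt j i.castSucc with hj | hj <;> rcases le_or_gt k i.castSucc with hk | hk
      · have := convexHull_min (Set.union_subset (hleft j hj) (hleft k hk)) (convex_Iio _) hxc
        linarith [Set.mem_Iio.1 this]
      · have := le_setDist hnj hnk fun y hy z hz => hsep y (hleft j hj hy) z (hright k hk hz)
        linarith
      · have := le_setDist hnk hnj fun y hy z hz => hsep y (hleft k hk hy) z (hright j hj hz)
        rw [setDist_comm] at this
        linarith
      · have := convexHull_min (Set.union_subset (hright j hj) (hright k hk)) (convex_Ioi _) hxc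
        linarith [Set.mem_Ioi.1 this]
    · have hemp : ∀ j, nbhdIn (O.interval lam) r₁ (O.clusterSeg lam j) = ∅ := by
        intro j
        ext z
        simp only [nbhdIn, h0, Set.mem_ofPred_eq, Set.mem_empty_iff_false, iff_false, not_and,
          not_lt, Nat.cast_zero]
        exact fun _ => Metric.infDist_nonneg
      simp [hemp] at hxc
  · have hself : ∀ (j : Fin (O.n + 1)), x ∈ nbhdIn (O.interval lam) r₁ (O.clusterSeg lam j) →
        x ∈ thickCluster (O.interval lam) (O.clusterSeg lam) r₁ r₂ := by
      intro j hj
      simp only [thickCluster, Set.mem_iUnion]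
      refine ⟨j, j, (setDist_le_dist hj hj).trans (by simp), ?_⟩
      exact subset_convexHull ℝ _ (Or.inl hj)
    rintro (h' | h')
    · exact hself _ (O.mem_nbhdIn_castSucc lam hx h')
    · exact hself _ (O.mem_nbhdIn_succ lam hx h')

/-- For `r₁ = 0` this would fail: nothing is thickened, yet `trimmedSeg` discards edges of length at
most `r₂`. -/
theorem thickEdgeSeg_eq_trimmedSeg {r₁ r₂ : ℕ} (hr : 0 < r₁) :
    O.thickEdgeSeg lam r₁ r₂ = trimmedSeg (O.edgeLo lam) O.edgeLen r₁ r₂ := by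
  funext i
  ext x
  simp only [thickEdgeSeg, thickEdge, trimmedSeg, Set.mem_inter_iff, Set.mem_sdiff]
  split_ifs with h
  · constructor
    · rintro ⟨hx, _, hx'⟩
      rw [O.mem_thickCluster_iff lam h hx, not_or, not_lt, not_lt, O.edgeHi_eq] at hx'
      exact hx'
    · intro hx
      have hx' : x ∈ O.edgeSeg lam i := by
        refine ⟨?_, ?_⟩
        · linarith [hx.1, show (0 : ℝ) ≤ r₁ by positivity]
        · rw [O.edgeHi_eq]
          linarith [hx.2, show (0 : ℝ) ≤ r₁ by positivity]
      refine ⟨hx', O.edgeSeg_subset_interval lam i hx', ?_⟩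
      rw [O.mem_thickCluster_iff lam h hx', not_or, not_lt, not_lt, O.edgeHi_eq]
      exact hx
  · refine iff_of_false ?_ (Set.notMem_empty x)
    rintro ⟨hx, _, hx'⟩
    exact hx' (O.mem_thickCluster_of_edgeLen_le lam hr (not_lt.1 h) hx)

end ClusterOrder

/-- An initial segment of `Fin k` is a cut, and cuts index the components of the complement of a
decomposition. -/
theorem exists_forall_castSucc_lt_iff {k : ℕ} (Q : Fin k → Prop)
    (hQ : ∀ i j, i ≤ j → Q j → Q i) : ∃ c : Fin (k + 1), ∀ j, j.castSucc < c ↔ Q j := by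
  induction k with
  | zero => exact ⟨0, fun j => j.elim0⟩
  | succ k ih =>
    by_cases hl : Q (Fin.last k)
    · exact ⟨Fin.last _, fun j => iff_of_true (Fin.castSucc_lt_last j) (hQ _ _ (Fin.le_last j) hl)⟩
    · obtain ⟨c, hc⟩ := ih (fun j => Q j.castSucc) fun i j hij => hQ _ _ (by simpa using hij)
      refine ⟨c.castSucc, fun j => ?_⟩
      induction j using Fin.lastCases with
      | last =>
        refine iff_of_false (not_lt.2 ?_) hl
        simpa using Fin.le_last c
      | cast j => simpa using hc j

/-! ### Size and number of unstable components. -/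

namespace EdgeDecomposition

variable {n k : ℕ} {A : Fin n → Set ℝ} (S : EdgeDecomposition A k)

theorem exists_subset_of_mem_unstable {D : Set ℝ} (hD : D ∈ S.unstable) :
    ∃ i, D.Nonempty ∧ IsPreconnected D ∧
      D ⊆ A i \ ⋃ (j : Fin k) (_ : S.piece j = i), S.seg j := by
  obtain ⟨i, x, hx, rfl⟩ := hD
  exact ⟨i, ⟨x, mem_connectedComponentIn hx⟩, isPreconnected_connectedComponentIn,
    connectedComponentIn_subset _ _⟩

/-- An unstable component is an interval that avoids the stable segments of its piece. -/
theorem diam_le_of_mem_unstable {B : ℝ} (hB : 0 ≤ B)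
    (h : ∀ i, ∀ x ∈ A i, ∀ y ∈ A i, x + B < y → ∃ j, S.piece j = i ∧
      ∃ z ∈ Set.Icc x y, z ∈ S.seg j) {D : Set ℝ} (hD : D ∈ S.unstable) : Metric.diam D ≤ B := by
  obtain ⟨i, _, hpc, hsub⟩ := S.exists_subset_of_mem_unstable hD
  have key : ∀ x ∈ D, ∀ y ∈ D, y ≤ x + B := by
    intro x hx y hy
    by_contra! hxy
    obtain ⟨j, hj, z, hz, hzj⟩ := h i x (hsub hx).1 y (hsub hy).1 hxy
    refine (hsub (hpc.ordConnected.out hx hy hz)).2 ?_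
    simp only [Set.mem_iUnion]
    exact ⟨j, hj, hzj⟩
  refine Metric.diam_le_of_forall_dist_le hB fun x hx y hy => ?_
  rw [Real.dist_eq, abs_le]
  constructor <;> linarith [key x hx y hy, key y hy x hx]

/-- A component is determined by its piece and by the number of stable segments of that piece to its
left. Pieces outside `bad` are covered and contribute none. -/
theorem finite_unstable_and_ncard_le (hA : ∀ i, (A i).OrdConnected) (bad : Finset (Fin n)) (K : ℕ)
    (hbad : ∀ i, i ∉ bad → ∀ x ∈ A i, ∃ j, S.piece j = i ∧ x ∈ S.seg j)
    (hK : ∀ i ∈ bad, (Finset.univ.filter fun j => S.piece j = i).card ≤ K) :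
    S.unstable.Finite ∧ S.unstable.ncard ≤ bad.card * (K + 1) := by
  classical
  let U : Fin n → Set ℝ := fun i => A i \ ⋃ (j : Fin k) (_ : S.piece j = i), S.seg j
  let cnt : Fin n → ℝ → ℕ := fun i x =>
    (Finset.univ.filter fun j => S.piece j = i ∧ S.hi j < x).card
  let T : Finset (Fin n × ℕ) := bad ×ˢ Finset.range (K + 1)
  have hsame : ∀ i x y, x ∈ U i → y ∈ U i → x ≤ y → cnt i x = cnt i y →
      connectedComponentIn (U i) x = connectedComponentIn (U i) y := by
    intro i x y hx hy hxy hc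
    refine (connectedComponentIn_eq ?_).symm
    refine isPreconnected_Icc.subset_connectedComponentIn (Set.right_mem_Icc.2 hxy) ?_
      (Set.left_mem_Icc.2 hxy)
    intro z hz
    refine ⟨(hA i).out hx.1 hy.1 hz, fun hz' => ?_⟩
    simp only [Set.mem_iUnion] at hz'
    obtain ⟨j, hj, hzj⟩ := hz'
    have hout : ∀ w ∈ U i, w < S.lo j ∨ S.hi j < w := by
      intro w hw
      by_contra! h
      exact hw.2 (by simp only [Set.mem_iUnion]; exact ⟨j, hj, h⟩)
    have hjy : S.hi j < y := by
      rcases hout y hy with h | h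
      · linarith [hzj.1, hz.2]
      · exact h
    have hjx : x < S.lo j := by
      rcases hout x hx with h | h
      · exact h
      · linarith [hzj.2, hz.1]
    -- A segment through `z` lies strictly between `x` and `y`, hence is counted for `y` but not for
    -- `x`.
    refine hc.not_lt (Finset.card_lt_card ?_)
    refine Finset.ssubset_iff_of_subset (fun l hl => ?_) |>.2 ⟨j, ?_, ?_⟩
    · simp only [Finset.mem_filter, Finset.mem_univ, true_and] at hl ⊢
      exact ⟨hl.1, hl.2.trans_le hxy⟩
    · simpa using ⟨hj, hjy⟩
    · simp only [Finset.mem_filter, Finset.mem_univ, true_and, not_and, not_lt]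
      intro _
      linarith [S.lo_le_hi j]
  have hmem : ∀ D ∈ S.unstable, ∃ q ∈ T, ∃ x ∈ U q.1, cnt q.1 x = q.2 ∧
      D = connectedComponentIn (U q.1) x := by
    rintro D ⟨i, x, hx, rfl⟩
    have hib : i ∈ bad := by
      by_contra hi
      obtain ⟨j, hj, hxj⟩ := hbad i hi x hx.1
      exact hx.2 (by simp only [Set.mem_iUnion]; exact ⟨j, hj, hxj⟩)
    refine ⟨(i, cnt i x), Finset.mem_product.2 ⟨hib, Finset.mem_range.2 ?_⟩, x, hx, rfl, rfl⟩
    refine Nat.lt_succ_of_le (le_trans (show cnt i x ≤ _ from Finset.card_le_card ?_) (hK i hib))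
    intro j hj
    simp only [Finset.mem_filter, Finset.mem_univ, true_and] at hj ⊢
    exact hj.1
  rcases S.unstable.eq_empty_or_nonempty with hemp | ⟨D₀, hD₀⟩
  · simp [hemp]
  have : Nonempty (Fin n × ℕ) := ⟨(hmem D₀ hD₀).choose⟩
  choose! q hqT x hxU hcnt hDx using hmem
  have hinj : Set.InjOn q S.unstable := by
    intro D hD D' hD' h
    rw [hDx D hD, hDx D' hD']
    have h1 := hxU D hD
    have h2 := hcnt D hD
    have h3 := hxU D' hD'
    have h4 := hcnt D' hD'
    rw [← h] at h3 h4 ⊢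
    rcases le_total (x D) (x D') with h' | h'
    · exact hsame _ _ _ h1 h3 h' (h2.trans h4.symm)
    · exact (hsame _ _ _ h3 h1 h' (h4.trans h2.symm)).symm
  have hmaps : Set.MapsTo q S.unstable T := fun D hD => hqT D hD
  have hfin : S.unstable.Finite := Set.Finite.of_injOn hmaps hinj T.finite_toSet
  refine ⟨hfin, ?_⟩
  have := Set.ncard_le_ncard_of_injOn q hmaps hinj T.finite_toSet
  rw [Set.ncard_coe_finset, Finset.card_product, Finset.card_range] at this
  exact this

theorem clusterSeg_subset_gap {Z : Type*} [MetricSpace Z] {E ε' : ℝ} {a b : Z} {Y : Finset Z}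
    (lam : GeodesicChoice Z) (O : ClusterOrder E ε' a b Y) {A : Fin O.n → Set ℝ}
    (S : EdgeDecomposition A k) (hA : ∀ i, A i ⊆ O.edgeSeg lam i) {i : Fin (O.n + 1)}
    {c : Fin (k + 1)} (hc : ∀ j, j.castSucc < c ↔ (S.piece j).castSucc < i) :
    O.clusterSeg lam i ⊆ S.gap (O.interval lam) c := by
  intro x hx
  refine ⟨O.clusterSeg_subset_interval lam i hx, fun j hj => ?_, fun j hj => ?_⟩
  · have h1 := hA _ (S.subset j (Set.right_mem_Icc.2 (S.lo_le_hi j)))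
    exact h1.2.trans ((O.edgeHi_le_clusterLo lam ((hc j).1 hj)).trans hx.1)
  · have h1 := hA _ (S.subset j (Set.left_mem_Icc.2 (S.lo_le_hi j)))
    have h2 : i ≤ (S.piece j).castSucc := not_lt.1 fun h => hj.not_gt ((hc j).2 h)
    exact hx.2.trans ((O.clusterHi_le_edgeLo lam h2).trans h1.1)

end EdgeDecomposition

/-- Segments `[pos i, pos i + len i]` of the line, in this order up to an additive error `2 c`. -/
structure EdgeLayout (n : ℕ) (c : ℝ) where
  len : Fin n → ℕ
  pos : Fin n → ℝ
  sep : ∀ i j, i < j → pos i + len i ≤ pos j + 2 * c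

/-! ### Matching two layouts of segments on the line. -/

namespace EdgeLayout

variable {n n' k : ℕ} {c : ℝ} (X : EdgeLayout n c) (X' : EdgeLayout n' c) (M r₁ r₂ : ℕ)

/-- The signed length of the intersection of two segments. -/
def overlap (i : Fin n) (i' : Fin n') : ℝ :=
  min (X.pos i + X.len i) (X'.pos i' + X'.len i') - max (X.pos i) (X'.pos i')

/-- Two segments are equal. -/
def Same (i : Fin n) (i' : Fin n') : Prop := X.pos i = X'.pos i' ∧ X.len i = X'.len i'

open Classical in
/-- The distance from the left end of the segment `i` of `X` to the part that is matched with a part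
of the segment `i'` of `X'`. -/
def offset (i : Fin n) (i' : Fin n') : ℕ :=
  if X.Same X' i i' then 0 else ⌈X'.pos i' - X.pos i⌉₊ + M

open Classical in
/-- The length of the matched part of two segments. -/
def size (i : Fin n) (i' : Fin n') : ℕ :=
  if X.Same X' i i' then X.len i else ⌊X.overlap X' i i'⌋₊ - (2 * M + 1)

open Classical in
/-- The pairs of segments with a matched part that has positive length after shortening it by `r₁`
at both ends. -/
def pairs : Finset (Fin n × Fin n') :=
  Finset.univ.filter fun q => (2 * M + 3 : ℝ) ≤ X.overlap X' q.1 q.2 ∧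
    2 * r₁ < X.size X' M q.1 q.2 ∧ 2 * r₁ + r₂ < X.len q.1 ∧ 2 * r₁ + r₂ < X'.len q.2

theorem mem_pairs {q : Fin n × Fin n'} : q ∈ X.pairs X' M r₁ r₂ ↔
    (2 * M + 3 : ℝ) ≤ X.overlap X' q.1 q.2 ∧ 2 * r₁ < X.size X' M q.1 q.2 ∧
    2 * r₁ + r₂ < X.len q.1 ∧ 2 * r₁ + r₂ < X'.len q.2 := by
  simp [pairs]

theorem overlap_comm (i : Fin n) (i' : Fin n') : X.overlap X' i i' = X'.overlap X i' i := by
  rw [overlap, overlap, min_comm, max_comm]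

theorem same_comm (i : Fin n) (i' : Fin n') : X.Same X' i i' ↔ X'.Same X i' i := by
  simp only [Same, eq_comm]

/-- Unlike `offset`, the length is symmetric, so the two members of a stable pair are isometric. -/
theorem size_comm (i : Fin n) (i' : Fin n') : X.size X' M i i' = X'.size X M i' i := by
  by_cases h : X.Same X' i i'
  · rw [size, size, if_pos h, if_pos ((X.same_comm X' i i').1 h), h.2]
  · rw [size, size, if_neg h, if_neg (fun h' => h ((X.same_comm X' i i').2 h')), overlap_comm]

theorem swap_mem_pairs {q : Fin n × Fin n'} (h : q ∈ X.pairs X' M r₁ r₂) :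
    q.swap ∈ X'.pairs X M r₁ r₂ := by
  rw [mem_pairs] at h ⊢
  rw [Prod.fst_swap, Prod.snd_swap, overlap_comm, size_comm]
  exact ⟨h.1, h.2.1, h.2.2.2, h.2.2.1⟩

theorem overlap_le (i : Fin n) (i' : Fin n') :
    X.overlap X' i i' ≤ X.len i ∧ X.overlap X' i i' ≤ X'.len i' ∧
    X.overlap X' i i' ≤ X.pos i + X.len i - X'.pos i' ∧
    X.overlap X' i i' ≤ X'.pos i' + X'.len i' - X.pos i := by
  have h1 := min_le_left (X.pos i + X.len i) (X'.pos i' + X'.len i')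
  have h2 := min_le_right (X.pos i + X.len i) (X'.pos i' + X'.len i')
  have h3 := le_max_left (X.pos i) (X'.pos i')
  have h4 := le_max_right (X.pos i) (X'.pos i')
  unfold overlap
  refine ⟨?_, ?_, ?_, ?_⟩ <;> linarith

theorem Same.overlap_eq {X : EdgeLayout n c} {X' : EdgeLayout n' c} {i : Fin n} {i' : Fin n'}
    (h : X.Same X' i i') : X.overlap X' i i' = X.len i := by
  simp [overlap, ← h.1, ← h.2]

/-- The matched part of the segment `i` lies in the intersection of the segments, and close to
its ends. -/
theorem matched_bounds {i : Fin n} {i' : Fin n'} (h : (2 * M + 3 : ℝ) ≤ X.overlap X' i i') :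
    max (X.pos i) (X'.pos i') ≤ X.pos i + X.offset X' M i i' ∧
    X.pos i + X.offset X' M i i' ≤ max (X.pos i) (X'.pos i') + 1 + M ∧
    X.pos i + X.offset X' M i i' + X.size X' M i i' ≤
      min (X.pos i + X.len i) (X'.pos i' + X'.len i') ∧
    min (X.pos i + X.len i) (X'.pos i' + X'.len i') ≤
      X.pos i + X.offset X' M i i' + X.size X' M i i' + M + 2 ∧
    (¬ X.Same X' i i' → X'.pos i' + M ≤ X.pos i + X.offset X' M i i' ∧
      X.pos i + X.offset X' M i i' + X.size X' M i i' + M ≤ X'.pos i' + X'.len i') := by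
  by_cases hs : X.Same X' i i'
  · have hM : (0 : ℝ) ≤ M := by positivity
    have h1 : X.offset X' M i i' = 0 := by rw [offset, if_pos hs]
    have h2 : X.size X' M i i' = X.len i := by rw [size, if_pos hs]
    rw [h1, h2, ← hs.1, ← hs.2, max_self, min_self]
    refine ⟨by simp, by simp; linarith, by simp, by simp; linarith, fun h => absurd hs h⟩
  -- This makes the truncated subtraction in `size` exact. The extra unit removed there pays for
  -- rounding the offset up.
  · have hfl : 2 * M + 3 ≤ ⌊X.overlap X' i i'⌋₊ := Nat.le_floor (by push_cast; exact h)
    have h1 : (X.offset X' M i i' : ℝ) = ⌈X'.pos i' - X.pos i⌉₊ + M := by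
      rw [offset, if_neg hs]
      push_cast
      rfl
    have h2 : (X.size X' M i i' : ℝ) = ⌊X.overlap X' i i'⌋₊ - (2 * M + 1) := by
      rw [size, if_neg hs, Nat.cast_sub (by omega)]
      push_cast
      rfl
    have h3 := Nat.floor_le (show 0 ≤ X.overlap X' i i' from le_trans (by positivity) h)
    have h4 := Nat.lt_floor_add_one (X.overlap X' i i')
    have h5 : max (X.pos i) (X'.pos i') ≤ X.pos i + ⌈X'.pos i' - X.pos i⌉₊ := by
      refine max_le (by simp) ?_
      linarith [Nat.le_ceil (X'.pos i' - X.pos i)]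
    have h6 : X.pos i + ⌈X'.pos i' - X.pos i⌉₊ ≤ max (X.pos i) (X'.pos i') + 1 := by
      rcases le_total (X'.pos i') (X.pos i) with h' | h'
      · rw [Nat.ceil_eq_zero.2 (by linarith), max_eq_left h']
        simp
      · rw [max_eq_right h']
        linarith [Nat.ceil_lt_add_one (show 0 ≤ X'.pos i' - X.pos i by linarith)]
    have h7 : X.overlap X' i i' = min (X.pos i + X.len i) (X'.pos i' + X'.len i') -
      max (X.pos i) (X'.pos i') := rfl
    have h8 := min_le_right (X.pos i + X.len i) (X'.pos i' + X'.len i')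
    have h9 := le_max_right (X.pos i) (X'.pos i')
    have hM : (0 : ℝ) ≤ M := by positivity
    rw [h1, h2]
    refine ⟨?_, ?_, ?_, ?_, fun _ => ⟨?_, ?_⟩⟩ <;> linarith

/-- Both matched parts begin between the larger of the two left ends and `M + 1` beyond it. -/
theorem abs_offset_sub_le {i : Fin n} {i' : Fin n'} (h : (2 * M + 3 : ℝ) ≤ X.overlap X' i i') :
    |X.pos i + X.offset X' M i i' - (X'.pos i' + X'.offset X M i' i)| ≤ M + 1 := by
  have h1 := X.matched_bounds X' M h
  have h2 := X'.matched_bounds X M (h.trans_eq (X.overlap_comm X' i i'))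
  rw [max_comm] at h2
  rw [abs_le]
  constructor <;> linarith [h1.1, h1.2.1, h2.1, h2.2.1]

section Chain

variable {X X' M}

/-- If the order were reversed, the two overlaps would add up to at most `4c`, by `sep` in both
layouts. -/
theorem snd_le_of_fst_lt {i j : Fin n} {i' j' : Fin n'}
    (h : (2 * M + 3 : ℝ) ≤ X.overlap X' i i') (h' : (2 * M + 3 : ℝ) ≤ X.overlap X' j j')
    (hM : c < M) (hij : i < j) : i' ≤ j' := by
  by_contra! hlt
  have h1 := X.sep i j hij
  have h2 := X'.sep j' i' hlt
  have h3 := X.overlap_le X' i i'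
  have h4 := X.overlap_le X' j j'
  linarith [h3.2.2.1, h4.2.2.2]

/-- A segment equal to `i'` overlaps every other segment of `X'` by at most `2c`. So a segment with
an equal partner is matched with nothing else. -/
theorem not_same_of_lt {i : Fin n} {i' j' : Fin n'}
    (h : (2 * M + 3 : ℝ) ≤ X.overlap X' i i') (h' : (2 * M + 3 : ℝ) ≤ X.overlap X' i j')
    (hM : c < M) (hij : i' < j') : ¬ X.Same X' i i' ∧ ¬ X.Same X' i j' := by
  have h1 := X'.sep i' j' hij
  have h3 := X.overlap_le X' i i'
  have h4 := X.overlap_le X' i j'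
  constructor
  · rintro ⟨h5, h6⟩
    rw [h5, h6] at h4
    linarith [h4.2.2.1]
  · rintro ⟨h5, h6⟩
    rw [h5] at h3
    linarith [h3.2.2.2]

theorem Same.eq_of_overlap {i : Fin n} {i' j' : Fin n'} (hs : X.Same X' i i')
    (h : (2 * M + 3 : ℝ) ≤ X.overlap X' i i') (h' : (2 * M + 3 : ℝ) ≤ X.overlap X' i j')
    (hM : c < M) : i' = j' := by
  rcases lt_trichotomy i' j' with hlt | heq | hlt
  · exact absurd hs (not_same_of_lt h h' hM hlt).1
  · exact heq
  · exact absurd hs (not_same_of_lt h' h hM hlt).2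

end Chain

/-- `e` lists the pairs of segments with a matched part from left to right. -/
structure IsMatching (e : Fin k → Fin n × Fin n') : Prop where
  mem : ∀ j, e j ∈ X.pairs X' M r₁ r₂
  exists_eq : ∀ q ∈ X.pairs X' M r₁ r₂, ∃ j, e j = q
  mono : ∀ i j, i < j → (e i).1 ≤ (e j).1 ∧ (e i).2 ≤ (e j).2 ∧ e i ≠ e j

theorem exists_isMatching (hM : c < M) :
    ∃ (k : ℕ) (e : Fin k → Fin n × Fin n'), X.IsMatching X' M r₁ r₂ e := by
  classical
  -- The lexicographic order is monotone in the second entry too, by `snd_le_of_fst_lt`.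
  let Q : Finset (Fin n ×ₗ Fin n') := (X.pairs X' M r₁ r₂).map toLex.toEmbedding
  let o := Q.orderEmbOfFin rfl
  have hmem : ∀ j, ofLex (o j) ∈ X.pairs X' M r₁ r₂ := by
    intro j
    have := Q.orderEmbOfFin_mem rfl j
    simpa [Q] using this
  refine ⟨Q.card, fun j => ofLex (o j), hmem, fun q hq => ?_, fun i j hij => ?_⟩
  · have hq' : toLex q ∈ Set.range o := by
      rw [Finset.range_orderEmbOfFin]
      simpa [Q] using hq
    obtain ⟨j, hj⟩ := hq'
    exact ⟨j, by rw [hj, ofLex_toLex]⟩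
  · have hlt : o i < o j := o.strictMono hij
    have h1 := ((X.mem_pairs X' M r₁ r₂).1 (hmem i)).1
    have h2 := ((X.mem_pairs X' M r₁ r₂).1 (hmem j)).1
    have hne : ofLex (o i) ≠ ofLex (o j) := fun h => hlt.ne (ofLex.injective h)
    rcases (Prod.Lex.lt_iff (x := o i) (y := o j)).1 hlt with h | ⟨h, h'⟩
    · exact ⟨h.le, snd_le_of_fst_lt h1 h2 hM h, hne⟩
    · exact ⟨h.le, h'.le, hne⟩

variable {X X' M r₁ r₂} {e : Fin k → Fin n × Fin n'}

theorem IsMatching.swap (h : X.IsMatching X' M r₁ r₂ e) :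
    X'.IsMatching X M r₁ r₂ (fun j => (e j).swap) where
  mem j := X.swap_mem_pairs X' M r₁ r₂ (h.mem j)
  exists_eq q hq := by
    obtain ⟨j, hj⟩ := h.exists_eq q.swap (X'.swap_mem_pairs X M r₁ r₂ hq)
    exact ⟨j, by rw [hj, Prod.swap_swap]⟩
  mono i j hij := by
    obtain ⟨h1, h2, h3⟩ := h.mono i j hij
    exact ⟨h2, h1, fun h' => h3 (Prod.swap_injective h')⟩

theorem IsMatching.injective (h : X.IsMatching X' M r₁ r₂ e) : Function.Injective e := by
  intro i j hij
  rcases lt_trichotomy i j with h' | h' | h'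
  · exact absurd hij (h.mono i j h').2.2
  · exact h'
  · exact absurd hij.symm (h.mono j i h').2.2

theorem IsMatching.overlap (h : X.IsMatching X' M r₁ r₂ e) (j : Fin k) :
    (2 * M + 3 : ℝ) ≤ X.overlap X' (e j).1 (e j).2 :=
  ((X.mem_pairs X' M r₁ r₂).1 (h.mem j)).1

theorem offset_add_size_le {i : Fin n} {i' : Fin n'} (h : (2 * M + 3 : ℝ) ≤ X.overlap X' i i') :
    (X.offset X' M i i' : ℝ) + X.size X' M i i' ≤ X.len i := by
  have h1 := (X.matched_bounds X' M h).2.2.1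
  have h2 := min_le_left (X.pos i + X.len i) (X'.pos i' + X'.len i')
  linarith

/-- The matched parts of the segments of `X`, shortened by `r₁` at both ends, inside segments with
the lengths of those of `X` and the left ends `base i`. -/
def IsMatching.decomposition (h : X.IsMatching X' M r₁ r₂ e) (hM : c < M) (base : Fin n → ℝ)
    (hbase : ∀ i j, i < j → base i + X.len i ≤ base j) :
    EdgeDecomposition (trimmedSeg base X.len r₁ r₂) k where
  piece j := (e j).1
  lo j := base (e j).1 + X.offset X' M (e j).1 (e j).2 + r₁
  hi j := base (e j).1 + X.offset X' M (e j).1 (e j).2 + X.size X' M (e j).1 (e j).2 - r₁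
  lo_le_hi j := by
    have h1 := ((X.mem_pairs X' M r₁ r₂).1 (h.mem j)).2.1
    have h2 : (2 : ℝ) * r₁ < X.size X' M (e j).1 (e j).2 := by exact_mod_cast h1
    linarith
  subset j := by
    have h1 := ((X.mem_pairs X' M r₁ r₂).1 (h.mem j)).2.2.1
    have h2 := offset_add_size_le (h.overlap j)
    have h3 : (0 : ℝ) ≤ X.offset X' M (e j).1 (e j).2 := by positivity
    rw [trimmedSeg, if_pos h1]
    exact Set.Icc_subset_Icc (by linarith) (by linarith)
  ordered i j hij := by
    have h2 := offset_add_size_le (h.overlap i)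
    have h3 : (0 : ℝ) ≤ X.offset X' M (e j).1 (e j).2 := by positivity
    have h4 : (0 : ℝ) ≤ r₁ := by positivity
    obtain ⟨h5, h6, h7⟩ := h.mono i j hij
    rcases h5.lt_or_eq with h5 | h5
    · linarith [hbase _ _ h5]
    -- Two matched parts in one segment come from different segments of `X'`. Neither pair is
    -- `Same`, so each part keeps a margin `M` inside its segment of `X'`; the total `2M` beats the
    -- error `2c` in `sep`.
    · have hlt : (e i).2 < (e j).2 := lt_of_le_of_ne h6 fun h8 => h7 (Prod.ext h5 h8)
      have h8 := h.overlap i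
      have h9 := h.overlap j
      rw [← h5] at h9 ⊢
      obtain ⟨hn, hn'⟩ := not_same_of_lt h8 h9 hM hlt
      have h10 := (X.matched_bounds X' M h8).2.2.2.2 hn
      have h11 := (X.matched_bounds X' M h9).2.2.2.2 hn'
      linarith [X'.sep _ _ hlt]
  disjoint i j hij heq := by
    have h4 : (0 : ℝ) ≤ r₁ := by positivity
    obtain ⟨h5, h6, h7⟩ := h.mono i j hij
    have hlt : (e i).2 < (e j).2 := lt_of_le_of_ne h6 fun h8 => h7 (Prod.ext heq h8)
    have h8 := h.overlap i
    have h9 := h.overlap j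
    rw [← heq] at h9 ⊢
    obtain ⟨hn, hn'⟩ := not_same_of_lt h8 h9 hM hlt
    have h10 := (X.matched_bounds X' M h8).2.2.2.2 hn
    have h11 := (X.matched_bounds X' M h9).2.2.2.2 hn'
    linarith [X'.sep _ _ hlt]

/-- Every part of a segment of `X` that is longer than `B` contains an interval of length `g` that
lies in one segment of `X'`, up to the additive error `c`. -/
def IsDense (X : EdgeLayout n c) (X' : EdgeLayout n' c) (g B : ℝ) : Prop :=
  ∀ i α β, X.pos i ≤ α → β ≤ X.pos i + X.len i → α + B < β →
    ∃ i' α', α ≤ α' ∧ α' + g ≤ β ∧ X'.pos i' ≤ α' + c ∧ α' + g ≤ X'.pos i' + X'.len i' + c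

section Decomposition

variable (h : X.IsMatching X' M r₁ r₂ e) (hM : c < M) (base : Fin n → ℝ)
  (hbase : ∀ i j, i < j → base i + X.len i ≤ base j)

/-- Density supplies an overlap long enough to be matched and to survive the trimming by `M` and
`r₁`. -/
theorem IsMatching.diam_unstable_le (hc : 0 ≤ c) {g B : ℝ} (hB : 0 ≤ B)
    (hd : X.IsDense X' g B) (hg : 2 * c + 2 * M + 2 * r₁ + r₂ + 6 ≤ g) {D : Set ℝ}
    (hD : D ∈ (h.decomposition hM base hbase).unstable) : Metric.diam D ≤ B := by
  have hM0 : (0 : ℝ) ≤ M := by positivity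
  have hr1 : (0 : ℝ) ≤ r₁ := by positivity
  have hr2 : (0 : ℝ) ≤ r₂ := by positivity
  refine EdgeDecomposition.diam_le_of_mem_unstable _ hB (fun i x hx y hy hxy => ?_) hD
  have hx' := trimmedSeg_subset _ _ _ _ _ hx
  have hy' := trimmedSeg_subset _ _ _ _ _ hy
  obtain ⟨i', α, h1, h2, h3, h4⟩ := hd i (X.pos i + (x - base i)) (X.pos i + (y - base i))
    (by linarith [hx'.1]) (by linarith [hy'.2]) (by linarith)
  have hmin : α + g - c ≤ min (X.pos i + X.len i) (X'.pos i' + X'.len i') :=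
    le_min (by linarith [hy'.2]) (by linarith)
  have hmax : max (X.pos i) (X'.pos i') ≤ α + c := max_le (by linarith [hx'.1]) (by linarith)
  have hov : g - 2 * c ≤ X.overlap X' i i' := by
    unfold EdgeLayout.overlap
    linarith
  have hov' : (2 * M + 3 : ℝ) ≤ X.overlap X' i i' := by linarith
  obtain ⟨b1, b2, b3, b4, -⟩ := X.matched_bounds X' M hov'
  have hle := X.overlap_le X' i i'
  have hsize : (2 * r₁ : ℝ) < X.size X' M i i' := by linarith
  have hlen : (2 * r₁ + r₂ : ℝ) < X.len i := by linarith [hle.1]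
  have hlen' : (2 * r₁ + r₂ : ℝ) < X'.len i' := by linarith [hle.2.1]
  have hq : (i, i') ∈ X.pairs X' M r₁ r₂ := (X.mem_pairs X' M r₁ r₂).2
    ⟨hov', by exact_mod_cast hsize, by exact_mod_cast hlen, by exact_mod_cast hlen'⟩
  obtain ⟨j, hj⟩ := h.exists_eq _ hq
  -- The midpoint of the common interval is deep enough to lie in the stable segment.
  refine ⟨j, by simp [IsMatching.decomposition, hj], base i + (α + g / 2 - X.pos i),
    ⟨by linarith, by linarith⟩, ?_⟩
  simp only [EdgeDecomposition.seg, IsMatching.decomposition, hj, Set.mem_Icc]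
  constructor <;> linarith

/-- A segment outside `bad` is matched entirely, with its equal partner. A segment in `bad` can only
be matched with segments in `bad'`, which bounds the number of its stable parts. -/
theorem IsMatching.unstable_finite (bad : Finset (Fin n)) (bad' : Finset (Fin n'))
    (hbad : ∀ i ∉ bad, (2 * M + 3 : ℝ) ≤ X.len i ∧ ∃ i' ∉ bad', X.Same X' i i')
    (hbad' : ∀ i' ∉ bad', (2 * M + 3 : ℝ) ≤ X'.len i' ∧ ∃ i ∉ bad, X.Same X' i i') :
    (h.decomposition hM base hbase).unstable.Finite ∧
    (h.decomposition hM base hbase).unstable.ncard ≤ bad.card * (bad'.card + 1) := by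
  refine EdgeDecomposition.finite_unstable_and_ncard_le _ (ordConnected_trimmedSeg _ _ _ _) bad
    bad'.card (fun i hi x hx => ?_) (fun i hi => ?_)
  · obtain ⟨hl, i', -, hs⟩ := hbad i hi
    have hlt : 2 * r₁ + r₂ < X.len i := by
      by_contra hlt
      rw [trimmedSeg, if_neg hlt] at hx
      exact hx
    have hsz : X.size X' M i i' = X.len i := by rw [size, if_pos hs]
    have hoff : X.offset X' M i i' = 0 := by rw [offset, if_pos hs]
    have hq : (i, i') ∈ X.pairs X' M r₁ r₂ := (X.mem_pairs X' M r₁ r₂).2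
      ⟨by rw [hs.overlap_eq]; exact hl, by rw [hsz]; omega, hlt, by rw [← hs.2]; exact hlt⟩
    obtain ⟨j, hj⟩ := h.exists_eq _ hq
    refine ⟨j, by simp [IsMatching.decomposition, hj], ?_⟩
    rw [trimmedSeg, if_pos hlt] at hx
    simpa [EdgeDecomposition.seg, IsMatching.decomposition, hj, hsz, hoff] using hx
  · refine Finset.card_le_card_of_injOn (fun j => (e j).2) ?_ ?_
    · intro j hj
      have hji : (e j).1 = i := (Finset.mem_filter.1 hj).2
      by_contra hj'
      obtain ⟨hl, i₀, hi₀, hs⟩ := hbad' (e j).2 hj'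
      have h1 : (2 * M + 3 : ℝ) ≤ X'.overlap X (e j).2 i₀ := by
        rw [((X.same_comm X' _ _).1 hs).overlap_eq]
        exact hl
      have h2 := (h.overlap j).trans_eq (X.overlap_comm X' _ _)
      rw [((X.same_comm X' _ _).1 hs).eq_of_overlap h1 h2 hM, hji] at hi₀
      exact hi₀ hi
    · intro j hj l hl hjl
      have hj' : (e j).1 = i := (Finset.mem_filter.1 hj).2
      have hl' : (e l).1 = i := (Finset.mem_filter.1 hl).2
      exact h.injective (Prod.ext (hj'.trans hl'.symm) hjl)

end Decomposition

end EdgeLayout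

/-! ### Pigeonhole lemmas. -/

section Counting

theorem card_le_of_diam_le {n d : ℕ} (s : Finset (Fin n))
    (hs : ∀ i ∈ s, ∀ j ∈ s, i < j → j.val ≤ i.val + d) : s.card ≤ d + 1 := by
  rcases s.eq_empty_or_nonempty with rfl | hne
  · simp
  · have hsub : s.image Fin.val ⊆ Finset.Icc (s.min' hne).val ((s.min' hne).val + d) := by
      intro k hk
      obtain ⟨j, hj, rfl⟩ := Finset.mem_image.1 hk
      refine Finset.mem_Icc.2 ⟨s.min'_le j hj, ?_⟩
      rcases (s.min'_le j hj).lt_or_eq with h | h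
      · exact hs _ (s.min'_mem hne) _ hj h
      · rw [← h]
        omega
    have := Finset.card_le_card hsub
    rw [Finset.card_image_of_injective _ Fin.val_injective, Nat.card_Icc] at this
    omega

/-- Among `K + 1` consecutive slots of length `g`, at most `K` are occupied. -/
theorem exists_gap {F : Finset ℝ} {K : ℕ} (hF : F.card ≤ K) {α β g : ℝ} (hg : 0 < g)
    (h : α + (K + 1) * g ≤ β) :
    ∃ α', α ≤ α' ∧ α' + g ≤ β ∧ ∀ x ∈ F, x < α' ∨ α' + g ≤ x := by
  -- Points left of `α` are assigned to slot `0`, which is harmless: only the number of marked slots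
  -- matters.
  have hlt : (F.image fun x => ⌊(x - α) / g⌋₊).card < (Finset.range (K + 1)).card := by
    rw [Finset.card_range]
    exact Nat.lt_succ_of_le (Finset.card_image_le.trans hF)
  obtain ⟨k, hk, hkF⟩ := Finset.exists_mem_notMem_of_card_lt_card hlt
  have hk' : (k : ℝ) ≤ K := by exact_mod_cast Nat.lt_succ_iff.1 (Finset.mem_range.1 hk)
  have hkg : 0 ≤ (k : ℝ) * g := by positivity
  refine ⟨α + k * g, by linarith, by nlinarith, fun x hx => ?_⟩
  by_contra! hx'
  refine hkF (Finset.mem_image.2 ⟨x, hx, ?_⟩)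
  have h0 : (k : ℝ) ≤ (x - α) / g := by
    rw [le_div_iff₀ hg]
    linarith
  rw [Nat.floor_eq_iff ((Nat.cast_nonneg k).trans h0)]
  refine ⟨h0, ?_⟩
  rw [div_lt_iff₀ hg]
  linarith

theorem exists_castSucc_and_not_succ {n : ℕ} {P : Fin (n + 1) → Prop} (h0 : P 0)
    (hl : ¬ P (Fin.last n)) : ∃ i : Fin n, P i.castSucc ∧ ¬ P i.succ := by
  by_contra! h
  exact hl (Fin.induction h0 h (Fin.last n))

end Counting

/-! ### Edge components as segments of the line, and those shared by both setups. -/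

namespace ClusterOrder

variable {Z : Type*} [MetricSpace Z] {δ E η ε' : ℝ} {a b a' b' : Z} {Y Y' : Finset Z} {f : Z → ℝ}
  {W : Set Z} (lam : GeodesicChoice Z) (O : ClusterOrder E ε' a b Y)
  (O' : ClusterOrder E ε' a' b' Y')

open Classical in
/-- The endpoint of `λ(C, C')` in `C`. -/
def _root_.StableIntervals.GeodesicChoice.startPt (C C' : Set Z) : Z :=
  if lam.path C C' 0 ∈ C then lam.path C C' 0 else lam.path C C' (setDist C C')

theorem cluster_finite (i : Fin (O.n + 1)) : (O.cluster i).Finite :=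
  (vertexSet_finite a b Y).subset (O.isCluster i).subset

/-- The error `1` arises when the chosen geodesic starts in the right-hand cluster: the fractional
part is then cut off at the left end of the edge, shifting the parametrisation. -/
theorem exists_edge_end (i : Fin O.n) :
    lam.startPt (O.cluster i.castSucc) (O.cluster i.succ) ∈ O.cluster i.castSucc ∧
    ∃ y ∈ O.cluster i.succ,
      dist (lam.startPt (O.cluster i.castSucc) (O.cluster i.succ)) y =
        setDist (O.cluster i.castSucc) (O.cluster i.succ) ∧
      ∀ t ∈ O.edgeSeg lam i,
        |dist (lam.startPt (O.cluster i.castSucc) (O.cluster i.succ)) (O.phi lam i t) -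
          (t - O.edgeLo lam i)| ≤ 1 ∧
        dist (lam.startPt (O.cluster i.castSucc) (O.cluster i.succ)) (O.phi lam i t) +
          dist (O.phi lam i t) y =
          dist (lam.startPt (O.cluster i.castSucc) (O.cluster i.succ)) y := by
  have hd := setDist_nonneg (O.cluster i.castSucc) (O.cluster i.succ)
  have hfl : (O.edgeLen i : ℝ) ≤ setDist (O.cluster i.castSucc) (O.cluster i.succ) :=
    Nat.floor_le hd
  have hfl' : setDist (O.cluster i.castSucc) (O.cluster i.succ) < O.edgeLen i + 1 :=
    Nat.lt_floor_add_one _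
  have hhi := O.edgeHi_eq lam i
  have hi := lam.isometry _ _ (O.cluster_finite i.castSucc) (O.isCluster _).nonempty
    (O.cluster_finite i.succ) (O.isCluster _).nonempty
  have he := lam.endpoints _ _ (O.cluster_finite i.castSucc) (O.isCluster _).nonempty
    (O.cluster_finite i.succ) (O.isCluster _).nonempty
  unfold GeodesicChoice.startPt phi
  set d := setDist (O.cluster i.castSucc) (O.cluster i.succ)
  by_cases h0 : lam.path (O.cluster i.castSucc) (O.cluster i.succ) 0 ∈ O.cluster i.castSucc
  · have hy : lam.path (O.cluster i.castSucc) (O.cluster i.succ) d ∈ O.cluster i.succ := by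
      rcases he with h | h
      · exact h.2
      · exact absurd (O.eq_of_mem_cluster h0 h.1) (Fin.castSucc_lt_succ).ne
    simp only [if_pos h0]
    have h0d := hi 0 ⟨le_rfl, hd⟩ d ⟨hd, le_rfl⟩
    rw [zero_sub, abs_neg, abs_of_nonneg hd] at h0d
    refine ⟨h0, _, hy, h0d, fun t ht => ?_⟩
    have ht1 : t - O.edgeLo lam i ∈ Set.Icc 0 d :=
      ⟨by linarith [ht.1], by linarith [ht.2]⟩
    have h1 := hi 0 ⟨le_rfl, hd⟩ _ ht1
    have h2 := hi _ ht1 d ⟨hd, le_rfl⟩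
    rw [zero_sub, abs_neg, abs_of_nonneg ht1.1] at h1
    rw [abs_of_nonpos (by linarith [ht1.2])] at h2
    rw [h1, h2, h0d]
    constructor
    · simp
    · ring
  · obtain ⟨hy, hx⟩ := he.resolve_left fun h => h0 h.1
    simp only [if_neg h0]
    have h0d := hi d ⟨hd, le_rfl⟩ 0 ⟨le_rfl, hd⟩
    rw [sub_zero, abs_of_nonneg hd] at h0d
    refine ⟨hx, _, hy, h0d, fun t ht => ?_⟩
    have ht1 : O.edgeHi lam i - t ∈ Set.Icc 0 d :=
      ⟨by linarith [ht.2], by linarith [ht.1]⟩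
    have h1 := hi d ⟨hd, le_rfl⟩ _ ht1
    have h2 := hi _ ht1 0 ⟨le_rfl, hd⟩
    rw [abs_of_nonneg (by linarith [ht1.2])] at h1
    rw [sub_zero, abs_of_nonneg ht1.1] at h2
    rw [h1, h2, h0d]
    constructor
    · rw [abs_le]
      constructor <;> linarith
    · ring

/-- The value of `f` at the left end of an edge component. -/
def edgePos (f : Z → ℝ) (i : Fin O.n) : ℝ :=
  f (lam.startPt (O.cluster i.castSucc) (O.cluster i.succ))

variable {O O'}

theorem mem_of_mem_cluster (hW : vertexSet a b Y ⊆ W) {i : Fin (O.n + 1)} {v : Z}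
    (hv : v ∈ O.cluster i) : v ∈ W :=
  hW ((O.isCluster i).subset hv)

theorem eta_nonneg (hf : IsCoarseCoordinate f η W) (hW : vertexSet a b Y ⊆ W) : 0 ≤ η := by
  have ha := hW (left_mem_vertexSet a b Y)
  simpa using hf.dist_le a ha a ha

theorem dist_le_of_mem_cluster (hf : IsCoarseCoordinate f η W) (hO : O.IsOrderedBy f)
    (hW : vertexSet a b Y ⊆ W)
    {i j : Fin (O.n + 1)} (hij : i < j) {u w : Z}
    (hu : u ∈ O.cluster i) (hw : w ∈ O.cluster j) : dist u w ≤ f w - f u + η := by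
  have h1 := hf.dist_le u (mem_of_mem_cluster hW hu) w (mem_of_mem_cluster hW hw)
  rw [abs_of_neg (by linarith [hO i j hij u hu w hw])] at h1
  linarith

/-- Within the left cluster, a point more than `η` beyond the start would be closer to the next
cluster than the minimal distance allows. -/
theorem le_edgePos (hf : IsCoarseCoordinate f η W) (hO : O.IsOrderedBy f)
    (hW : vertexSet a b Y ⊆ W)
    {i : Fin O.n} {j : Fin (O.n + 1)} (hj : j ≤ i.castSucc) {v : Z}
    (hv : v ∈ O.cluster j) : f v ≤ O.edgePos lam f i + η := by
  obtain ⟨hx, y, hy, hxy, -⟩ := O.exists_edge_end lam i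
  have hη := eta_nonneg hf hW
  rcases hj.eq_or_lt with rfl | hj
  · have h1 := setDist_le_dist hv hy
    have h2 := dist_le_of_mem_cluster hf hO hW Fin.castSucc_lt_succ hv hy
    have h3 := hf.lipschitz y (lam.startPt (O.cluster i.castSucc) (O.cluster i.succ))
    rw [dist_comm] at h3
    unfold edgePos
    linarith
  · have := hO _ _ hj v hv _ hx
    unfold edgePos
    linarith

theorem edgePos_add_edgeLen_le (hf : IsCoarseCoordinate f η W) (hO : O.IsOrderedBy f)
    (hW : vertexSet a b Y ⊆ W)
    {i : Fin O.n} {j : Fin (O.n + 1)} (hj : i.castSucc < j) {v : Z}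
    (hv : v ∈ O.cluster j) : O.edgePos lam f i + O.edgeLen i ≤ f v + η := by
  obtain ⟨hx, y, hy, hxy, -⟩ := O.exists_edge_end lam i
  have hfl : (O.edgeLen i : ℝ) ≤ setDist (O.cluster i.castSucc) (O.cluster i.succ) :=
    Nat.floor_le (setDist_nonneg _ _)
  have key : ∀ w ∈ O.cluster i.succ, O.edgePos lam f i + O.edgeLen i ≤ f w + η := by
    intro w hw
    have h1 := setDist_le_dist hx hw
    have h2 := dist_le_of_mem_cluster hf hO hW Fin.castSucc_lt_succ hx hw
    unfold edgePos
    linarith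
  rcases (Fin.castSucc_lt_iff_succ_le.1 hj).eq_or_lt with rfl | hj
  · exact key v hv
  · linarith [key y hy, hO _ _ hj y hy v hv]

theorem exists_le_edgePos_add_edgeLen (hf : IsCoarseCoordinate f η W) (i : Fin O.n) :
    ∃ y ∈ O.cluster i.succ, f y ≤ O.edgePos lam f i + O.edgeLen i + 1 := by
  obtain ⟨hx, y, hy, hxy, -⟩ := O.exists_edge_end lam i
  have hfl' : setDist (O.cluster i.castSucc) (O.cluster i.succ) < O.edgeLen i + 1 :=
    Nat.lt_floor_add_one _
  refine ⟨y, hy, ?_⟩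
  have h3 := hf.lipschitz y (lam.startPt (O.cluster i.castSucc) (O.cluster i.succ))
  rw [dist_comm] at h3
  unfold edgePos
  linarith

/-- The layout of the edge components along the coordinate `f`. -/
def layout (hf : IsCoarseCoordinate f η W) (hO : O.IsOrderedBy f)
    (hW : vertexSet a b Y ⊆ W)
    : EdgeLayout O.n (η + 1) where
  len := O.edgeLen
  pos := O.edgePos lam f
  sep i j hij := by
    have h1 := edgePos_add_edgeLen_le lam hf hO hW (Fin.castSucc_lt_castSucc_iff.2 hij)
      (O.exists_edge_end lam j).1
    have := eta_nonneg hf hW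
    unfold edgePos at h1 ⊢
    linarith

theorem add_mul_le (hf : IsCoarseCoordinate f η W) (hO : O.IsOrderedBy f)
    (hW : vertexSet a b Y ⊆ W)
    {i j : Fin (O.n + 1)} (hij : i < j) {u w : Z} (hu : u ∈ O.cluster i)
    (hw : w ∈ O.cluster j) : f u + (j.val - i.val : ℝ) * (E - η) ≤ f w := by
  obtain ⟨m, hm⟩ : ∃ m, j.val = i.val + 1 + m :=
    Nat.exists_eq_add_of_le (Nat.succ_le_of_lt (Fin.lt_def.1 hij))
  induction m generalizing j w with
  | zero =>
    have h1 := (O.isCluster i).le_dist (O.isCluster j)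
      (fun h => hij.ne (O.cluster_injective h)) hu hw
    have h2 := dist_le_of_mem_cluster hf hO hW hij hu hw
    rw [hm]
    push_cast
    linarith
  | succ m ih =>
    let k : Fin (O.n + 1) := ⟨i.val + 1 + m, by omega⟩
    obtain ⟨v, hv⟩ := (O.isCluster k).nonempty
    have h0 := ih (j := k) (Fin.lt_def.2 (by simp only [k]; omega)) hv rfl
    have hkj : k < j := Fin.lt_def.2 (by simp only [k]; omega)
    have h1 := (O.isCluster k).le_dist (O.isCluster j)
      (fun h => hkj.ne (O.cluster_injective h)) hv hw
    have h2 := dist_le_of_mem_cluster hf hO hW hkj hv hw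
    have h3 : (k.val : ℝ) = i.val + 1 + m := by simp [k]
    rw [hm]
    rw [h3] at h0
    push_cast
    linarith

variable (O O') in
/-- Two edge components join the same clusters. -/
def SameEdge (i : Fin O.n) (i' : Fin O'.n) : Prop :=
  O.cluster i.castSucc = O'.cluster i'.castSucc ∧ O.cluster i.succ = O'.cluster i'.succ

open Classical in
variable (O O') in
/-- The edge components of `O` that are not edge components of `O'`. -/
def badEdges : Finset (Fin O.n) :=
  Finset.univ.filter fun i => ¬ ∃ i', O.SameEdge O' i i'

theorem notMem_badEdges {i : Fin O.n} :
    i ∉ O.badEdges O' ↔ ∃ i', O.SameEdge O' i i' := by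
  simp [badEdges]

theorem SameEdge.symm {i : Fin O.n} {i' : Fin O'.n} (h : O.SameEdge O' i i') :
    O'.SameEdge O i' i := ⟨h.1.symm, h.2.symm⟩

/-- The geodesic depends only on the pair of clusters, so here the maps agree exactly and not just
coarsely. -/
theorem SameEdge.phi_eq {i : Fin O.n} {i' : Fin O'.n} (h : O.SameEdge O' i i') {x x' : ℝ}
    (hx : x - O.edgeLo lam i = x' - O'.edgeLo lam i') : O.phi lam i x = O'.phi lam i' x' := by
  have hlen : O.edgeLen i = O'.edgeLen i' := by
    unfold edgeLen
    rw [h.1, h.2]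
  have hx' : O.edgeHi lam i - x = O'.edgeHi lam i' - x' := by
    rw [edgeHi_eq, edgeHi_eq, hlen]
    linarith
  simp only [phi, hx, hx']
  rw [h.1, h.2]

/-- The edge component `i` is close to the point `x`. -/
def IsCharged (O : ClusterOrder E ε' a b Y) (f : Z → ℝ) (η : ℝ) (i : Fin O.n) (x : Z) : Prop :=
  (∃ u ∈ O.cluster i.castSucc, f u ≤ f x + E + η) ∧
    ∃ v ∈ O.cluster i.succ, f x ≤ f v + E + η

/-- Edges with indices five apart enclose four cluster steps, each raising `f` by at least `E - η`,
but both are within `E + η` of `f x`. -/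
theorem IsCharged.val_le (hf : IsCoarseCoordinate f η W) (hO : O.IsOrderedBy f)
    (hW : vertexSet a b Y ⊆ W)
    {x : Z} {i j : Fin O.n} (hE : 10 * η < E)
    (hi : O.IsCharged f η i x) (hj : O.IsCharged f η j x) : j.val ≤ i.val + 4 := by
  obtain ⟨-, v, hv, hvx⟩ := hi
  obtain ⟨⟨u, hu, hux⟩, -⟩ := hj
  by_contra! hlt
  have hη := eta_nonneg hf hW
  have h1 := add_mul_le hf hO hW (i := i.succ) (j := j.castSucc)
    (Fin.lt_def.2 (by simp only [Fin.val_succ, Fin.val_castSucc]; omega)) hv hu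
  simp only [Fin.val_succ, Fin.val_castSucc, Nat.cast_add, Nat.cast_one] at h1
  have h2 : (i.val : ℝ) + 5 ≤ j.val := by exact_mod_cast hlt
  have h3 : 4 * (E - η) ≤ ((j.val : ℝ) - (i.val + 1)) * (E - η) :=
    mul_le_mul_of_nonneg_right (by linarith) (by linarith)
  linarith

/-- The two vertex sets agree near the edge, so both of its end clusters persist and no new cluster
appears between them. -/
theorem exists_sameEdge (hf : IsCoarseCoordinate f η W) (hO : O.IsOrderedBy f)
    (hW : vertexSet a b Y ⊆ W)
    (hO' : O'.IsOrderedBy f) (hE : 10 * η < E) {i : Fin O.n}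
    (h : ∀ x ∈ symmDiff (vertexSet a b Y) (vertexSet a' b' Y'), ¬ O.IsCharged f η i x) :
    ∃ i', O.SameEdge O' i i' := by
  have hη := eta_nonneg hf hW
  have hlt := hO _ _ (Fin.castSucc_lt_succ (i := i))
  have hmem' : ∀ x ∈ vertexSet a b Y, O.IsCharged f η i x → x ∈ vertexSet a' b' Y' :=
    fun x hx hc => by_contra fun hx' => h x (Or.inl ⟨hx, hx'⟩) hc
  have hmem : ∀ x ∈ vertexSet a' b' Y', O.IsCharged f η i x → x ∈ vertexSet a b Y :=
    fun x hx hc => by_contra fun hx' => h x (Or.inr ⟨hx, hx'⟩) hc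
  obtain ⟨u₀, hu₀⟩ := (O.isCluster i.castSucc).nonempty
  obtain ⟨v₀, hv₀⟩ := (O.isCluster i.succ).nonempty
  have hC : IsCluster E (vertexSet a' b' Y') (O.cluster i.castSucc) := by
    refine (O.isCluster i.castSucc).of_agree (fun u hu => ?_) (fun u hu x hx hd => ?_)
    · refine hmem' u ((O.isCluster _).subset hu) ⟨⟨u, hu, by linarith⟩, v₀, hv₀, ?_⟩
      linarith [hlt u hu v₀ hv₀]
    · have h1 := hf.lipschitz u x
      have h2 := hf.lipschitz x u
      rw [dist_comm] at h2
      exact hmem x hx ⟨⟨u, hu, by linarith⟩, v₀, hv₀, by linarith [hlt u hu v₀ hv₀]⟩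
  have hC' : IsCluster E (vertexSet a' b' Y') (O.cluster i.succ) := by
    refine (O.isCluster i.succ).of_agree (fun v hv => ?_) (fun v hv x hx hd => ?_)
    · refine hmem' v ((O.isCluster _).subset hv) ⟨⟨u₀, hu₀, ?_⟩, v, hv, by linarith⟩
      linarith [hlt u₀ hu₀ v hv]
    · have h1 := hf.lipschitz v x
      have h2 := hf.lipschitz x v
      rw [dist_comm] at h2
      exact hmem x hx ⟨⟨u₀, hu₀, by linarith [hlt u₀ hu₀ v hv]⟩, v, hv, by linarith⟩
  obtain ⟨j, hj⟩ := O'.exists_cluster_eq hC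
  obtain ⟨k, hk⟩ := O'.exists_cluster_eq hC'
  have hjk : j < k := by
    rcases lt_trichotomy j k with h' | h' | h'
    · exact h'
    · subst h'
      exact absurd (O.cluster_injective (hj.symm.trans hk)) Fin.castSucc_lt_succ.ne
    · linarith [hO' _ _ h' v₀ (hk ▸ hv₀) u₀ (hj ▸ hu₀), hlt u₀ hu₀ v₀ hv₀]
  obtain ⟨i', rfl⟩ := Fin.exists_castSucc_eq.2 (hjk.trans_le (Fin.le_last k)).ne
  refine ⟨i', hj.symm, ?_⟩
  rw [← hk]
  congr 1
  -- A cluster of `O'` strictly between would contain a vertex of the first setup, whose cluster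
  -- would lie strictly between two consecutive ones.
  by_contra hne
  have hlt' : i'.succ < k := lt_of_le_of_ne (Fin.castSucc_lt_iff_succ_le.1 hjk) (Ne.symm hne)
  obtain ⟨w, hw⟩ := (O'.isCluster i'.succ).nonempty
  have h1 := hO' _ _ Fin.castSucc_lt_succ u₀ (hj ▸ hu₀) w hw
  have h2 := hO' _ _ hlt' w hw v₀ (hk ▸ hv₀)
  have hwV := hmem w ((O'.isCluster _).subset hw)
    ⟨⟨u₀, hu₀, by linarith⟩, v₀, hv₀, by linarith⟩
  obtain ⟨l, hl⟩ := O.exists_mem_cluster hwV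
  have hl1 : i.castSucc < l := by
    by_contra! hle
    rcases hle.eq_or_lt with heq | hlt
    · subst heq
      have := O'.eq_of_mem_cluster (hj ▸ hl) hw
      exact Fin.castSucc_lt_succ.ne this
    · linarith [hO _ _ hlt w hl u₀ hu₀]
  have hl2 : l < i.succ := by
    by_contra! hle
    rcases hle.eq_or_lt with heq | hlt
    · subst heq
      have := O'.eq_of_mem_cluster (hk ▸ hl) hw
      exact hlt'.ne' this
    · linarith [hO _ _ hlt v₀ hv₀ w hl]
  exact absurd (Fin.castSucc_lt_iff_succ_le.1 hl1) hl2.not_ge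

/-- Each bad edge is charged to a point of the symmetric difference, and a point is charged by edges
in a window of five indices. -/
theorem card_badEdges_le (hf : IsCoarseCoordinate f η W) (hO : O.IsOrderedBy f)
    (hW : vertexSet a b Y ⊆ W) (hO' : O'.IsOrderedBy f)
    (hE : 10 * η < E) {K : ℕ}
    (hK : (symmDiff (vertexSet a b Y) (vertexSet a' b' Y')).ncard ≤ K) :
    (O.badEdges O').card ≤ 5 * K := by
  classical
  have hfin : (symmDiff (vertexSet a b Y) (vertexSet a' b' Y')).Finite :=
    ((vertexSet_finite a b Y).union (vertexSet_finite a' b' Y')).subset symmDiff_le_sup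
  have hx : ∀ i ∈ O.badEdges O', ∃ x ∈ symmDiff (vertexSet a b Y) (vertexSet a' b' Y'),
      O.IsCharged f η i x := by
    intro i hi
    by_contra! h
    exact notMem_badEdges.2 (exists_sameEdge hf hO hW hO' hE h) hi
  have : Nonempty Z := ⟨a⟩
  choose! x hx hxc using hx
  rw [Set.ncard_eq_toFinset_card _ hfin] at hK
  refine (Finset.card_le_mul_card_image_of_maps_to (f := x) (t := hfin.toFinset)
    (fun i hi => hfin.mem_toFinset.2 (hx i hi)) 5 fun z _ => ?_).trans (Nat.mul_le_mul_left 5 hK)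
  refine card_le_of_diam_le (d := 4) _ fun i hi j hj _ => ?_
  rw [Finset.mem_filter] at hi hj
  exact IsCharged.val_le hf hO hW hE (hi.2 ▸ hxc i hi.1) (hj.2 ▸ hxc j hj.1)

/-- A gap of length at least `E` in the values of the second vertex set cannot be crossed inside a
cluster, so a single edge of `O'` spans it. -/
theorem isDense_layout (hf : IsCoarseCoordinate f η W) (hO : O.IsOrderedBy f)
    (hW : vertexSet a b Y ⊆ W)
    (hO' : O'.IsOrderedBy f) (hW' : vertexSet a' b' Y' ⊆ W) {K : ℕ}
    (hK : (symmDiff (vertexSet a b Y) (vertexSet a' b' Y')).ncard ≤ K)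
    (ha : f a' ≤ f a + η) (hb : f b ≤ f b' + η) {g : ℝ} (hg : E ≤ g) (hg0 : 0 < g) :
    (layout lam hf hO hW).IsDense (layout lam hf hO' hW') g ((K + 1) * g + 2 * (2 * η + 1)) := by
  classical
  intro i α β hα hβ hαβ
  change O.edgePos lam f i ≤ α at hα
  change β ≤ O.edgePos lam f i + O.edgeLen i at hβ
  have hη := eta_nonneg hf hW
  have hfin : (symmDiff (vertexSet a b Y) (vertexSet a' b' Y')).Finite :=
    ((vertexSet_finite a b Y).union (vertexSet_finite a' b' Y')).subset symmDiff_le_sup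
  rw [Set.ncard_eq_toFinset_card _ hfin] at hK
  -- The margins `2η + 1` keep the gap clear of the common vertices and put `a'` and `b'` on
  -- opposite sides of it.
  obtain ⟨α', h1, h2, h3⟩ := exists_gap (F := hfin.toFinset.image f)
    (Finset.card_image_le.trans hK) hg0
    (show α + (2 * η + 1) + (K + 1) * g ≤ β - (2 * η + 1) by linarith)
  have hV : ∀ v ∈ vertexSet a b Y, f v < α' - η ∨ α' + g + η ≤ f v := by
    intro v hv
    obtain ⟨j, hj⟩ := O.exists_mem_cluster hv
    rcases le_or_gt j i.castSucc with h | h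
    · left
      linarith [le_edgePos lam hf hO hW h hj]
    · right
      linarith [edgePos_add_edgeLen_le lam hf hO hW h hj]
  have hV' : ∀ v ∈ vertexSet a' b' Y', f v < α' ∨ α' + g ≤ f v := by
    intro v hv
    by_cases hv' : v ∈ vertexSet a b Y
    · rcases hV v hv' with h | h
      · left; linarith
      · right; linarith
    · exact h3 _ (Finset.mem_image_of_mem f (hfin.mem_toFinset.2 (Or.inr ⟨hv, hv'⟩)))
  have hcl : IsProximityClosed E (vertexSet a' b' Y') {v | f v < α'} := by
    intro u hu _ x hx hd
    have h4 := hf.lipschitz x u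
    rw [dist_comm] at h4
    have hu' : f u < α' := hu
    rcases hV' x hx with h | h
    · exact h
    · linarith
  have haV : f a' < α' := by
    have := le_edgePos lam hf hO hW (Fin.zero_le i.castSucc) O.a_mem
    linarith
  have hbV : α' + g ≤ f b' := by
    have := edgePos_add_edgeLen_le lam hf hO hW
      (i.castSucc_lt_last) O.b_mem
    linarith
  -- Every cluster is on one side of the gap; the first change of side from `a'` to `b'` gives the
  -- edge.
  obtain ⟨i', ⟨v, hv, hvα⟩, hi'⟩ := exists_castSucc_and_not_succ
    (P := fun j => ∃ v ∈ O'.cluster j, f v < α') ⟨a', O'.a_mem, haV⟩ (by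
      rintro ⟨v, hv, hvα⟩
      have := (O'.isCluster _).subset_of_isProximityClosed hcl hv hvα O'.b_mem
      have : f b' < α' := this
      linarith)
  refine ⟨i', α', by linarith, by linarith, ?_, ?_⟩
  · have h4 : f _ < α' := (O'.isCluster _).subset_of_isProximityClosed hcl hv hvα
      (O'.exists_edge_end lam i').1
    change O'.edgePos lam f i' ≤ _
    unfold edgePos
    linarith
  · obtain ⟨y, hy, hyl⟩ := exists_le_edgePos_add_edgeLen lam hf i'
    change _ ≤ O'.edgePos lam f i' + O'.edgeLen i' + _
    rcases hV' y ((O'.isCluster _).subset hy) with h | h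
    · exact absurd ⟨y, hy, h⟩ hi'
    · linarith

theorem SameEdge.same (hf : IsCoarseCoordinate f η W) (hO : O.IsOrderedBy f)
    (hW : vertexSet a b Y ⊆ W)
    {i : Fin O.n} {i' : Fin O'.n} (h : O.SameEdge O' i i')
    (hO' : O'.IsOrderedBy f) (hW' : vertexSet a' b' Y' ⊆ W) :
    (layout lam hf hO hW).Same (layout lam hf hO' hW') i i' := by
  constructor
  · change O.edgePos lam f i = O'.edgePos lam f i'
    rw [edgePos, edgePos, h.1, h.2]
  · change O.edgeLen i = O'.edgeLen i'
    rw [edgeLen, edgeLen, h.1, h.2]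

theorem le_edgeLen (i : Fin O.n) : E - 1 ≤ O.edgeLen i := by
  have h1 : E ≤ setDist (O.cluster i.castSucc) (O.cluster i.succ) :=
    le_setDist (O.isCluster _).nonempty (O.isCluster _).nonempty fun x hx y hy =>
      (O.isCluster _).le_dist (O.isCluster _)
        (fun h => Fin.castSucc_lt_succ.ne (O.cluster_injective h)) hx hy
  have := Nat.lt_floor_add_one (setDist (O.cluster i.castSucc) (O.cluster i.succ))
  unfold edgeLen
  linarith

theorem abs_phi_sub_le (hf : IsCoarseCoordinate f η W) (hO : O.IsOrderedBy f)
    (hW : vertexSet a b Y ⊆ W)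
    {i : Fin O.n} {t : ℝ} (ht : t ∈ O.edgeSeg lam i) :
    |f (O.phi lam i t) - (O.edgePos lam f i + (t - O.edgeLo lam i))| ≤ η + 1 := by
  obtain ⟨hx, y, hy, hxy, hphi⟩ := O.exists_edge_end lam i
  obtain ⟨h1, h2⟩ := hphi t ht
  have h3 := dist_le_of_mem_cluster hf hO hW Fin.castSucc_lt_succ hx hy
  have h4 := hf.lipschitz (O.phi lam i t) (lam.startPt (O.cluster i.castSucc) (O.cluster i.succ))
  have h5 := hf.lipschitz y (O.phi lam i t)
  rw [dist_comm] at h4 h5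
  rw [abs_le] at h1 ⊢
  unfold edgePos
  constructor <;> linarith

/-- The image of an edge almost realises the triangle equality between `p` and `q`, as needed for
`IsHyperbolicGeodesicSpace.exists_near`. -/
theorem dist_add_dist_phi_le {p q : Z} (hf : IsCoarseCoordinate (dist p) η W)
    (hO : O.IsOrderedBy (dist p)) (hW : vertexSet a b Y ⊆ W) (hq : q ∈ W)
    (hqW : ∀ v ∈ W, dist p v ≤ dist p q + η) {i : Fin O.n} {t : ℝ} (ht : t ∈ O.edgeSeg lam i) :
    dist p (O.phi lam i t) + dist (O.phi lam i t) q ≤ dist p q + 4 * η := by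
  obtain ⟨hx, y, hy, hxy, hphi⟩ := O.exists_edge_end lam i
  obtain ⟨-, h2⟩ := hphi t ht
  have h3 := dist_le_of_mem_cluster hf hO hW Fin.castSucc_lt_succ hx hy
  have hyW := mem_of_mem_cluster hW hy
  have h4 := hf.dist_le y hyW q hq
  have h5 : |dist p y - dist p q| ≤ dist p q - dist p y + 2 * η := by
    rw [abs_le]
    have := hqW y hyW
    have := eta_nonneg hf hW
    constructor <;> linarith
  have h6 := dist_triangle p (lam.startPt (O.cluster i.castSucc) (O.cluster i.succ))
    (O.phi lam i t)
  have h7 := dist_triangle (O.phi lam i t) y q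
  have := eta_nonneg hf hW
  linarith

end ClusterOrder

/-- The translation between two compact intervals of the same length. -/
def iccTranslation {a b a' b' : ℝ} (h : b - a = b' - a') : Set.Icc a b ≃ᵢ Set.Icc a' b' where
  toFun x := ⟨x - a + a', by linarith [x.2.1], by linarith [x.2.2]⟩
  invFun x := ⟨x - a' + a, by linarith [x.2.1], by linarith [x.2.2]⟩
  left_inv x := Subtype.ext (by simp)
  right_inv x := Subtype.ext (by simp)
  isometry_toFun := Isometry.of_dist_eq fun x y => by
    simp [Subtype.dist_eq]

theorem IsAdmissible.symm {Z : Type*} [MetricSpace Z] {lam : GeodesicChoice Z} {N ε : ℝ}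
    {a b a' b' : Z} {Y Y' : Finset Z} (h : IsAdmissible lam N ε a b Y a' b' Y') :
    IsAdmissible lam N ε a' b' Y' a b Y where
  setup := h.setup'
  setup' := h.setup
  dist_a := by rw [dist_comm]; exact h.dist_a
  dist_b := by rw [dist_comm]; exact h.dist_b
  close y hy := (h.close y hy.symm).symm
  card_symmDiff := by rw [symmDiff_comm]; exact h.card_symmDiff

theorem IsAdmissible.exists_near {Z : Type*} [MetricSpace Z] {lam : GeodesicChoice Z} {N ε : ℝ}
    {a b a' b' : Z} {Y Y' : Finset Z} (h : IsAdmissible lam N ε a b Y a' b' Y') (hε : 0 < ε) :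
    ∃ γ : ℝ → Z, IsGeodesicSegment γ a b ∧ ∀ v ∈ vertexSet a b Y ∪ vertexSet a' b' Y',
      ∃ t ∈ Set.Icc 0 (dist a b), dist v (γ t) ≤ ε := by
  obtain ⟨γ, hγ, hcar⟩ := lam.exists_isGeodesicSegment a b
  refine ⟨γ, hγ, fun v hv => ?_⟩
  have hY : ∀ y, (y ∈ Y ∨ y ∈ Y') → ∃ t ∈ Set.Icc 0 (dist a b), dist y (γ t) ≤ ε := by
    intro y hy
    have h1 := (h.close y hy).1
    rw [hcar, Metric.infDist_lt_iff ((Set.nonempty_Icc.2 dist_nonneg).image _)] at h1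
    obtain ⟨_, ⟨t, ht, rfl⟩, hd⟩ := h1
    exact ⟨t, ht, by linarith⟩
  have ha : ∀ y, dist a y ≤ ε → ∃ t ∈ Set.Icc 0 (dist a b), dist y (γ t) ≤ ε := fun y hy =>
    ⟨0, ⟨le_rfl, dist_nonneg⟩, by rw [hγ.1, dist_comm]; exact hy⟩
  have hb : ∀ y, dist b y ≤ ε → ∃ t ∈ Set.Icc 0 (dist a b), dist y (γ t) ≤ ε := fun y hy =>
    ⟨dist a b, ⟨dist_nonneg, le_rfl⟩, by rw [hγ.2.1, dist_comm]; exact hy⟩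
  rcases hv with (hv | rfl | rfl) | (hv | rfl | rfl)
  · exact hY v (Or.inl hv)
  · exact ha _ (by simpa using hε.le)
  · exact hb _ (by simpa using hε.le)
  · exact hY v (Or.inr hv)
  · exact ha _ h.dist_a
  · exact hb _ h.dist_b

/-- The summand `4` accounts for the endpoints. -/
theorem IsAdmissible.ncard_symmDiff_le {Z : Type*} [MetricSpace Z] {lam : GeodesicChoice Z}
    {N ε : ℝ} {a b a' b' : Z} {Y Y' : Finset Z} (h : IsAdmissible lam N ε a b Y a' b' Y') :
    (symmDiff (vertexSet a b Y) (vertexSet a' b' Y')).ncard ≤ ⌈N⌉₊ + 4 := by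
  have hsub : symmDiff (vertexSet a b Y) (vertexSet a' b' Y') ⊆
      symmDiff (Y : Set Z) Y' ∪ {a, b, a', b'} := by
    rintro x (⟨hx, hx'⟩ | ⟨hx, hx'⟩) <;>
    · simp only [vertexSet, Set.mem_union, Set.mem_insert_iff, Set.mem_singleton_iff,
        Set.mem_symmDiff, not_or] at hx hx' ⊢
      tauto
  have hfin : (symmDiff (Y : Set Z) Y').Finite :=
    (Y.finite_toSet.union Y'.finite_toSet).subset symmDiff_le_sup
  have h4 : ({a, b, a', b'} : Set Z).ncard ≤ 4 := by
    classical
    have := Finset.card_le_four (a := a) (b := b) (c := a') (d := b')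
    rw [← Set.ncard_coe_finset] at this
    simpa using this
  have hN : (symmDiff (Y : Set Z) Y').ncard ≤ ⌈N⌉₊ := by
    have := h.card_symmDiff.le.trans (Nat.le_ceil N)
    exact_mod_cast this
  calc _ ≤ (symmDiff (Y : Set Z) Y' ∪ {a, b, a', b'}).ncard :=
        Set.ncard_le_ncard hsub (hfin.union (by simp))
    _ ≤ _ := (Set.ncard_union_le _ _).trans (Nat.add_le_add hN h4)

/-! ### Integrality and nesting of the matched parts. -/

namespace EdgeLayout

variable {n n' k : ℕ} {c : ℝ} {X : EdgeLayout n c} {X' : EdgeLayout n' c} {M r₁ r₂ : ℕ}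
  {e : Fin k → Fin n × Fin n'} (h : X.IsMatching X' M r₁ r₂ e) (hM : c < M) (base : Fin n → ℝ)
  (hbase : ∀ i j, i < j → base i + X.len i ≤ base j)

theorem IsMatching.exists_length (j : Fin k) : ∃ m : ℕ, 0 < m ∧
    (h.decomposition hM base hbase).hi j - (h.decomposition hM base hbase).lo j = m := by
  have h1 := ((X.mem_pairs X' M r₁ r₂).1 (h.mem j)).2.1
  refine ⟨X.size X' M (e j).1 (e j).2 - 2 * r₁, by omega, ?_⟩
  rw [Nat.cast_sub h1.le]
  simp only [IsMatching.decomposition]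
  push_cast
  ring

theorem IsMatching.exists_vertex (j : Fin k) : ∃ m : ℕ,
    (h.decomposition hM base hbase).lo j =
      base ((h.decomposition hM base hbase).piece j) + m := by
  refine ⟨X.offset X' M (e j).1 (e j).2 + r₁, ?_⟩
  simp only [IsMatching.decomposition]
  push_cast
  ring

theorem IsMatching.hi_sub_lo_swap (base' : Fin n' → ℝ)
    (hbase' : ∀ i j, i < j → base' i + X'.len i ≤ base' j) (j : Fin k) :
    (h.decomposition hM base hbase).hi j - (h.decomposition hM base hbase).lo j =
    (h.swap.decomposition hM base' hbase').hi j -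
      (h.swap.decomposition hM base' hbase').lo j := by
  simp only [IsMatching.decomposition, Prod.fst_swap, Prod.snd_swap]
  rw [X.size_comm X' M]
  ring

theorem pairs_subset_pairs_zero {q : Fin n × Fin n'} (hq : q ∈ X.pairs X' M r₁ r₂) :
    q ∈ X.pairs X' M 0 0 := by
  rw [mem_pairs] at hq ⊢
  exact ⟨hq.1, by omega, by omega, by omega⟩

/-- Offsets and sizes do not involve `r₁`, `r₂`; these only filter the pairs and shorten the matched
parts. -/
theorem IsMatching.seg_subset_seg {l : ℕ} {e₀ : Fin l → Fin n × Fin n'}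
    (h₀ : X.IsMatching X' M 0 0 e₀) (j : Fin k) :
    ∃ j₀, (h.decomposition hM base hbase).seg j ⊆
      (h₀.decomposition hM base hbase).seg j₀ := by
  obtain ⟨j₀, hj₀⟩ := h₀.exists_eq _ (pairs_subset_pairs_zero (h.mem j))
  refine ⟨j₀, ?_⟩
  simp only [EdgeDecomposition.seg, IsMatching.decomposition, hj₀, Nat.cast_zero, add_zero,
    sub_zero]
  exact Set.Icc_subset_Icc (by simp) (by simp)

end EdgeLayout

/-! ### Stable compatibility of the matched decompositions. -/

namespace ClusterOrder

variable {Z : Type*} [MetricSpace Z] {δ E η ε' : ℝ} {a b a' b' : Z} {Y Y' : Finset Z} {f : Z → ℝ}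
  {W : Set Z} {lam : GeodesicChoice Z} {O : ClusterOrder E ε' a b Y}
  {O' : ClusterOrder E ε' a' b' Y'}

theorem edgeLo_add_edgeLen_le (lam : GeodesicChoice Z) (O : ClusterOrder E ε' a b Y)
    (i j : Fin O.n) (hij : i < j) : O.edgeLo lam i + O.edgeLen i ≤ O.edgeLo lam j := by
  rw [← edgeHi_eq]
  exact O.edgeHi_le_edgeLo lam hij

theorem trimmedSeg_subset_edgeSeg (lam : GeodesicChoice Z) (O : ClusterOrder E ε' a b Y)
    (r₁ r₂ : ℕ) (i : Fin O.n) :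
    trimmedSeg (O.edgeLo lam) O.edgeLen r₁ r₂ i ⊆ O.edgeSeg lam i := by
  rw [edgeSeg, edgeHi_eq]
  exact trimmedSeg_subset _ _ _ _ _

variable (hf : IsCoarseCoordinate f η W) (hO : O.IsOrderedBy f) (hW : vertexSet a b Y ⊆ W)
  (hO' : O'.IsOrderedBy f) (hW' : vertexSet a' b' Y' ⊆ W) {k M r₁ r₂ : ℕ}
  {e : Fin k → Fin O.n × Fin O'.n}

theorem sameEdge_of_notMem_badEdges
    (h : (layout lam hf hO hW).IsMatching (layout lam hf hO' hW') M r₁ r₂ e) (hM : η + 1 < M)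
    (hE : 2 * M + 4 ≤ E) {j : Fin k}
    (hj : (e j).1 ∉ O.badEdges O') : O.SameEdge O' (e j).1 (e j).2 := by
  obtain ⟨i', hi'⟩ := notMem_badEdges.1 hj
  have hs := hi'.same lam hf hO hW hO' hW'
  have h1 : (2 * M + 3 : ℝ) ≤ (layout lam hf hO hW).overlap (layout lam hf hO' hW') (e j).1 i' := by
    rw [hs.overlap_eq]
    have := O.le_edgeLen (e j).1
    change _ ≤ (O.edgeLen (e j).1 : ℝ)
    linarith
  rwa [← hs.eq_of_overlap h1 (h.overlap j) hM]

/-- If `y` were to the right of one segment of a pair and to the left of the other, their overlap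
would be at most `2η`. -/
theorem lt_iff_lt_of_mem_cluster
    (h : (layout lam hf hO hW).IsMatching (layout lam hf hO' hW') M r₁ r₂ e) (hM : η + 1 < M)
    {y : Z} {i : Fin (O.n + 1)} {i' : Fin (O'.n + 1)}
    (hy : y ∈ O.cluster i) (hy' : y ∈ O'.cluster i') (j : Fin k) :
    (e j).1.castSucc < i ↔ (e j).2.castSucc < i' := by
  have h1 := h.overlap j
  have h2 := (layout lam hf hO hW).overlap_le (layout lam hf hO' hW') (e j).1 (e j).2
  have hM0 : (0 : ℝ) ≤ M := by positivity
  have p1 : (layout lam hf hO hW).pos = O.edgePos lam f := rfl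
  have p2 : (layout lam hf hO' hW').pos = O'.edgePos lam f := rfl
  have l1 : (layout lam hf hO hW).len = O.edgeLen := rfl
  have l2 : (layout lam hf hO' hW').len = O'.edgeLen := rfl
  rw [p1, p2, l1, l2] at h2
  constructor
  · intro hlt
    by_contra! hle
    have h3 := edgePos_add_edgeLen_le lam hf hO hW hlt hy
    have h4 := le_edgePos lam hf hO' hW' hle hy'
    linarith [h2.2.2.1]
  · intro hlt
    by_contra! hle
    have h3 := edgePos_add_edgeLen_le lam hf hO' hW' hlt hy'
    have h4 := le_edgePos lam hf hO hW hle hy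
    linarith [h2.2.2.2]

theorem exists_gap_of_iff (h : (layout lam hf hO hW).IsMatching (layout lam hf hO' hW') M r₁ r₂ e)
    (hM : η + 1 < M) {i : Fin (O.n + 1)} {i' : Fin (O'.n + 1)}
    (hi : ∀ j, (e j).1.castSucc < i ↔ (e j).2.castSucc < i') : ∃ c,
    O.clusterSeg lam i ⊆ (h.decomposition hM (O.edgeLo lam)
      (O.edgeLo_add_edgeLen_le lam)).gap (O.interval lam) c ∧
    O'.clusterSeg lam i' ⊆ (h.swap.decomposition hM (O'.edgeLo lam)
      (O'.edgeLo_add_edgeLen_le lam)).gap (O'.interval lam) c := by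
  obtain ⟨c, hc⟩ := exists_forall_castSucc_lt_iff (fun j => (e j).1.castSucc < i) (by
    intro j l hjl hl
    rcases hjl.eq_or_lt with rfl | hjl
    · exact hl
    · exact lt_of_le_of_lt (Fin.castSucc_le_castSucc_iff.2 (h.mono j l hjl).1) hl)
  refine ⟨c, ?_, ?_⟩
  · exact EdgeDecomposition.clusterSeg_subset_gap lam O _
      (O.trimmedSeg_subset_edgeSeg lam r₁ r₂) fun j => hc j
  · exact EdgeDecomposition.clusterSeg_subset_gap lam O' _
      (O'.trimmedSeg_subset_edgeSeg lam r₁ r₂) fun j => (hc j).trans (hi j)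

theorem unstable_decomposition {K : ℕ} {g B : ℝ}
    (h : (layout lam hf hO hW).IsMatching (layout lam hf hO' hW') M r₁ r₂ e) (hM : η + 1 < M)
    (hE : 10 * η < E) (hE' : 2 * M + 4 ≤ E)
    (hK : (symmDiff (vertexSet a b Y) (vertexSet a' b' Y')).ncard ≤ K)
    (ha : f a' ≤ f a + η) (hb : f b ≤ f b' + η)
    (hg : E + 2 * (η + 1) + 2 * M + 2 * r₁ + r₂ + 6 ≤ g)
    (hB : B = (K + 1) * g + 2 * (2 * η + 1)) :
    ((h.decomposition hM (O.edgeLo lam) (O.edgeLo_add_edgeLen_le lam)).unstable.Finite ∧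
    (h.decomposition hM (O.edgeLo lam) (O.edgeLo_add_edgeLen_le lam)).unstable.ncard ≤
      5 * K * (5 * K + 1)) ∧
    ∀ D ∈ (h.decomposition hM (O.edgeLo lam) (O.edgeLo_add_edgeLen_le lam)).unstable,
      Metric.diam D ≤ B := by
  have hη := eta_nonneg hf hW
  have hM0 : (0 : ℝ) ≤ M := by positivity
  have hr1 : (0 : ℝ) ≤ r₁ := by positivity
  have hr2 : (0 : ℝ) ≤ r₂ := by positivity
  have hg0 : 0 < g := by linarith
  have hK' : (symmDiff (vertexSet a' b' Y') (vertexSet a b Y)).ncard ≤ K := by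
    rwa [symmDiff_comm]
  have hb1 := card_badEdges_le (O' := O') hf hO hW hO' hE hK
  have hb2 := card_badEdges_le (O' := O) hf hO' hW' hO hE hK'
  constructor
  · have hgood : ∀ i ∉ O.badEdges O', (2 * M + 3 : ℝ) ≤ O.edgeLen i ∧
        ∃ i' ∉ O'.badEdges O, (layout lam hf hO hW).Same (layout lam hf hO' hW') i i' := by
      intro i hi
      obtain ⟨i', hi'⟩ := notMem_badEdges.1 hi
      exact ⟨by linarith [O.le_edgeLen i], i', notMem_badEdges.2 ⟨i, hi'.symm⟩,
        hi'.same lam hf hO hW hO' hW'⟩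
    have hgood' : ∀ i' ∉ O'.badEdges O, (2 * M + 3 : ℝ) ≤ O'.edgeLen i' ∧
        ∃ i ∉ O.badEdges O', (layout lam hf hO hW).Same (layout lam hf hO' hW') i i' := by
      intro i' hi'
      obtain ⟨i, hi⟩ := notMem_badEdges.1 hi'
      exact ⟨by linarith [O'.le_edgeLen i'], i, notMem_badEdges.2 ⟨i', hi.symm⟩,
        hi.symm.same lam hf hO hW hO' hW'⟩
    obtain ⟨h1, h2⟩ := h.unstable_finite hM (O.edgeLo lam) (O.edgeLo_add_edgeLen_le lam) _ _
      hgood hgood'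
    exact ⟨h1, h2.trans (Nat.mul_le_mul hb1 (Nat.succ_le_succ hb2))⟩
  · intro D hD
    refine h.diam_unstable_le hM (O.edgeLo lam) (O.edgeLo_add_edgeLen_le lam) (by linarith)
      (g := g) ?_ ?_ (by linarith) hD
    · rw [hB]
      positivity
    · rw [hB]
      exact isDense_layout lam hf hO hW hO' hW' hK ha hb (by linarith) hg0

/-- The decompositions given by a matching of the edge components are compatible. -/
theorem stablyCompatible_decomposition (hZ : IsHyperbolicGeodesicSpace δ Z) {K : ℕ} {g L : ℝ}
    (hf : IsCoarseCoordinate (dist a) η W) (hO : O.IsOrderedBy (dist a))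
    (hW : vertexSet a b Y ⊆ W) (hO' : O'.IsOrderedBy (dist a)) (hW' : vertexSet a' b' Y' ⊆ W)
    (h : (layout lam hf hO hW).IsMatching (layout lam hf hO' hW') M r₁ r₂ e) (hM : η + 1 < M)
    (hE : 10 * η < E) (hE' : 2 * M + 4 ≤ E)
    (hK : (symmDiff (vertexSet a b Y) (vertexSet a' b' Y')).ncard ≤ K)
    (ha : dist a a' ≤ η) (hb : dist b b' ≤ η) (hbW : ∀ v ∈ W, dist a v ≤ dist a b + η)
    (hg : E + 2 * (η + 1) + 2 * M + 2 * r₁ + r₂ + 6 ≤ g)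
    (hL : (5 * K * (5 * K + 1) : ℝ) ≤ L) (hL' : (K + 1) * g + 2 * (2 * η + 1) ≤ L)
    (hL'' : M + 3 + 2 * η + 4 * (2 * δ + 4 * η) < L) :
    StablyCompatible lam O O'
      (h.decomposition hM (O.edgeLo lam) (O.edgeLo_add_edgeLen_le lam))
      (h.swap.decomposition hM (O'.edgeLo lam) (O'.edgeLo_add_edgeLen_le lam))
      ((Y : Set Z) ∩ Y') L := by
  have hcard : ∀ {m : ℕ}, m ≤ 5 * K * (5 * K + 1) → (m : ℝ) ≤ L := fun hm =>
    le_trans (by exact_mod_cast hm) hL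
  have hK' : (symmDiff (vertexSet a' b' Y') (vertexSet a b Y)).ncard ≤ K := by
    rwa [symmDiff_comm]
  have hbad := card_badEdges_le (O' := O') hf hO hW hO' hE hK
  have hbad' := card_badEdges_le (O' := O) hf hO' hW' hO hE hK'
  obtain ⟨hu1, hu2⟩ := unstable_decomposition hf hO hW hO' hW' h hM hE hE' hK
    (by simpa using ha) (by linarith [dist_triangle a b' b, dist_comm b b']) hg rfl
  obtain ⟨hu1', hu2'⟩ := unstable_decomposition hf hO' hW' hO hW h.swap hM hE hE'
    hK' (by simp [eta_nonneg hf hW, add_nonneg])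
    (by linarith [dist_triangle a b b']) hg rfl
  have hη := eta_nonneg hf hW
  have hbW' : b ∈ W := hW (right_mem_vertexSet a b Y)
  obtain ⟨γ, hγ⟩ := hZ.exists_geodesic a b
  refine
    { length := h.exists_length hM _ _
      length' := h.swap.exists_length hM _ _
      vertex := h.exists_vertex hM _ _
      vertex' := h.swap.exists_vertex hM _ _
      pairs := ⟨fun j => iccTranslation (h.hi_sub_lo_swap hM _ (O.edgeLo_add_edgeLen_le lam) _
        (O'.edgeLo_add_edgeLen_le lam) j), fun j x y hxy => ?_, ?_, fun j x => ?_⟩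
      unstable_finite := ⟨hu1.1, hcard hu1.2⟩
      unstable_finite' := ⟨hu1'.1, hcard hu1'.2⟩
      unstable_diam := fun D hD => (hu2 D hD).trans hL'
      unstable_diam' := fun D hD => (hu2' D hD).trans hL'
      end_a := fun i i' hi hi' => ?_
      end_b := fun i i' hi hi' => ?_
      label := fun y hy i i' hi hi' => ?_ }
  · have hxy' : (x : ℝ) ≤ y := hxy
    change (x : ℝ) - _ + _ ≤ (y : ℝ) - _ + _
    linarith
  -- Pairs with different maps inject into the product of the two sets of bad edges.
  · refine hcard (le_trans ?_ (Nat.mul_le_mul hbad (hbad'.trans (Nat.le_succ _))))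
    rw [← Finset.card_product, ← Set.ncard_coe_finset]
    refine Set.ncard_le_ncard_of_injOn e (fun j hj => ?_) h.injective.injOn
    have hns : ¬ O.SameEdge O' (e j).1 (e j).2 := by
      intro hs
      -- For a shared edge both offsets vanish, so the translation preserves the parameter along the
      -- edge.
      refine hj fun x => hs.phi_eq lam ?_
      have hs' := hs.same lam hf hO hW hO' hW'
      have h1 : (layout lam hf hO hW).offset (layout lam hf hO' hW') M (e j).1 (e j).2 = 0 := by
        rw [EdgeLayout.offset, if_pos hs']
      have h2 : (layout lam hf hO' hW').offset (layout lam hf hO hW) M (e j).2 (e j).1 = 0 := by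
        rw [EdgeLayout.offset, if_pos ((EdgeLayout.same_comm _ _ _ _).1 hs')]
      change (x : ℝ) - O.edgeLo lam (e j).1 = x - (O.edgeLo lam (e j).1 +
        (layout lam hf hO hW).offset (layout lam hf hO' hW') M (e j).1 (e j).2 + r₁) +
        (O'.edgeLo lam (e j).2 +
          (layout lam hf hO' hW').offset (layout lam hf hO hW) M (e j).2 (e j).1 + r₁) -
        O'.edgeLo lam (e j).2
      rw [h1, h2]
      ring
    rw [Finset.mem_coe, Finset.mem_product]
    constructor
    · by_contra hj'
      exact hns (sameEdge_of_notMem_badEdges hf hO hW hO' hW' h hM hE' hj')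
    · by_contra hj'
      exact hns (sameEdge_of_notMem_badEdges hf hO' hW' hO hW h.swap hM hE' hj').symm
  · have hx : (x : ℝ) ∈ O.edgeSeg lam (e j).1 := O.trimmedSeg_subset_edgeSeg lam r₁ r₂ _
      ((h.decomposition hM (O.edgeLo lam) (O.edgeLo_add_edgeLen_le lam)).subset j x.2)
    generalize hx_def : iccTranslation (h.hi_sub_lo_swap hM (O.edgeLo lam)
      (O.edgeLo_add_edgeLen_le lam) (O'.edgeLo lam) (O'.edgeLo_add_edgeLen_le lam) j) x = x'
    have hx' : (x' : ℝ) ∈ O'.edgeSeg lam (e j).2 := O'.trimmedSeg_subset_edgeSeg lam r₁ r₂ _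
      ((h.swap.decomposition hM (O'.edgeLo lam) (O'.edgeLo_add_edgeLen_le lam)).subset j x'.2)
    have hxx : (x' : ℝ) - O'.edgeLo lam (e j).2 -
        (layout lam hf hO' hW').offset (layout lam hf hO hW) M (e j).2 (e j).1 =
        x - O.edgeLo lam (e j).1 -
        (layout lam hf hO hW).offset (layout lam hf hO' hW') M (e j).1 (e j).2 := by
      rw [← hx_def]
      change (x : ℝ) - (O.edgeLo lam (e j).1 +
        (layout lam hf hO hW).offset (layout lam hf hO' hW') M (e j).1 (e j).2 + r₁) +
        (O'.edgeLo lam (e j).2 +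
          (layout lam hf hO' hW').offset (layout lam hf hO hW) M (e j).2 (e j).1 + r₁) -
        O'.edgeLo lam (e j).2 - _ = _
      ring
    change dist (O.phi lam (e j).1 x) (O'.phi lam (e j).2 x') < L
    have h1 := abs_phi_sub_le lam hf hO hW hx
    have h2 := abs_phi_sub_le lam hf hO' hW' hx'
    have h3 := (layout lam hf hO hW).abs_offset_sub_le (layout lam hf hO' hW') M (h.overlap j)
    change |O.edgePos lam (dist a) (e j).1 + _ - (O'.edgePos lam (dist a) (e j).2 + _)| ≤ _ at h3
    have h4 := dist_le_of_near_geodesic hγ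
      (hZ.exists_near hγ (dist_add_dist_phi_le lam hf hO hW hbW' hbW hx))
      (hZ.exists_near hγ (dist_add_dist_phi_le lam hf hO' hW' hbW' hbW hx'))
    refine h4.trans_lt (lt_of_le_of_lt ?_ hL'')
    rw [abs_le] at h1 h2 h3
    -- The offsets contribute `M + 1`, and each image point `η + 1`.
    have h5 : |dist a (O.phi lam (e j).1 x) - dist a (O'.phi lam (e j).2 x')| ≤
        M + 3 + 2 * η := by
      rw [abs_le]
      constructor <;> linarith [h1.1, h1.2, h2.1, h2.2, h3.1, h3.2]
    linarith
  · obtain rfl := O.eq_of_mem_cluster hi O.a_mem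
    obtain rfl := O'.eq_of_mem_cluster hi' O'.a_mem
    exact exists_gap_of_iff hf hO hW hO' hW' h hM fun j => by simp
  · obtain rfl := O.eq_of_mem_cluster hi O.b_mem
    obtain rfl := O'.eq_of_mem_cluster hi' O'.b_mem
    exact exists_gap_of_iff hf hO hW hO' hW' h hM fun j =>
      iff_of_true (Fin.castSucc_lt_last _) (Fin.castSucc_lt_last _)
  · exact exists_gap_of_iff hf hO hW hO' hW' h hM
      (lt_iff_lt_of_mem_cluster hf hO hW hO' hW' h hM hi hi')

end ClusterOrder

end StableIntervals

end

/-! ### The theorem, with explicit constants. -/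

open StableIntervals
theorem mainTheorem5 (δ ε : ℝ) (hε : 0 < ε) :
    ∃ ε₀ : ℝ, ∀ ε' : ℝ, ε₀ ≤ ε' → ∃ E₀ : ℝ, ∀ E : ℝ, E₀ ≤ E →
    ∀ N : ℝ, 0 < N → ∃ L₁ : ℝ, 0 < L₁ ∧ ∀ r₁ r₂ : ℕ, 0 < r₁ → 0 < r₂ → ∃ L₂ : ℝ, 0 < L₂ ∧
    ∀ (Z : Type*) [MetricSpace Z], IsHyperbolicGeodesicSpace δ Z →
    ∀ (lam : GeodesicChoice Z) (a b a' b' : Z) (Y Y' : Finset Z),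
    IsAdmissible lam N ε a b Y a' b' Y' →
      Nonempty (ClusterOrder E ε' a b Y) ∧ Nonempty (ClusterOrder E ε' a' b' Y') ∧
      ∀ (O : ClusterOrder E ε' a b Y) (O' : ClusterOrder E ε' a' b' Y'),
        ∃ (k : ℕ) (S : EdgeDecomposition (O.edgeSeg lam) k)
          (S' : EdgeDecomposition (O'.edgeSeg lam) k),
          StablyCompatible lam O O' S S' ((Y : Set Z) ∩ Y') L₁ ∧
          ∃ (m : ℕ) (R : EdgeDecomposition (O.thickEdgeSeg lam r₁ r₂) m)
            (R' : EdgeDecomposition (O'.thickEdgeSeg lam r₁ r₂) m),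
            StablyCompatible lam O O' R R' ((Y : Set Z) ∩ Y') L₂ ∧
            (∀ i, ∃ j, R.seg i ⊆ S.seg j) ∧ (∀ i, ∃ j, R'.seg i ⊆ S'.seg j) := by
  -- With `η = 4ε`, the trimming `M` must exceed the layout error `η + 1`.
  obtain ⟨M, hM⟩ : ∃ M : ℕ, 4 * ε + 1 < M := exists_nat_gt _
  refine ⟨|δ| + 4 * ε, fun ε' hε' => ⟨50 * ε + 4 * |ε'| + 2 * M + 5, fun E hE N _ => ?_⟩⟩
  have habs := le_abs_self ε'
  have habs' := abs_nonneg ε'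
  have hδ := le_abs_self δ
  have hδ' := abs_nonneg δ
  have hM0 : (0 : ℝ) ≤ M := by positivity
  set K : ℕ := ⌈N⌉₊ + 4 with hK
  let g : ℕ → ℕ → ℝ := fun r₁ r₂ => E + 2 * (4 * ε + 1) + 2 * M + 2 * r₁ + r₂ + 6
  -- The sum of the bounds for the number of exceptions, their diameter and the distance of paired
  -- points.
  let L : ℕ → ℕ → ℝ := fun r₁ r₂ => 5 * K * (5 * K + 1) +
    ((K + 1) * g r₁ r₂ + 2 * (2 * (4 * ε) + 1)) +
    (M + 3 + 2 * (4 * ε) + 4 * (2 * |δ| + 4 * (4 * ε))) + 1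
  have hg : ∀ r₁ r₂, 0 < g r₁ r₂ := fun r₁ r₂ => by
    have : (0 : ℝ) ≤ r₁ := by positivity
    have : (0 : ℝ) ≤ r₂ := by positivity
    simp only [g]
    linarith
  have hK0 : (0 : ℝ) ≤ 5 * K * (5 * K + 1) := by positivity
  have hKg : ∀ r₁ r₂, 0 < (K + 1) * g r₁ r₂ := fun r₁ r₂ => mul_pos (by positivity) (hg r₁ r₂)
  have hL : ∀ r₁ r₂, 0 < L r₁ r₂ := fun r₁ r₂ => by
    have := hKg r₁ r₂
    simp only [L]
    linarith
  refine ⟨L 0 0, hL 0 0, fun r₁ r₂ hr₁ _ => ⟨L r₁ r₂, hL r₁ r₂, ?_⟩⟩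
  intro Z _ hZ lam a b a' b' Y Y' hadm
  obtain ⟨γ, hγ, hnear⟩ := hadm.exists_near hε
  obtain ⟨γ', hγ', hnear'⟩ := hadm.symm.exists_near hε
  have hf := isCoarseCoordinate_dist hγ hnear
  have hf' := isCoarseCoordinate_dist hγ' hnear'
  have hW : vertexSet a b Y ⊆ vertexSet a b Y ∪ vertexSet a' b' Y' := Set.subset_union_left
  have hW' : vertexSet a' b' Y' ⊆ vertexSet a b Y ∪ vertexSet a' b' Y' := Set.subset_union_right
  have hW'' : vertexSet a' b' Y' ⊆ vertexSet a' b' Y' ∪ vertexSet a b Y := Set.subset_union_left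
  have hend : ∀ {p q : Z} {β : ℝ → Z} {v : Z}, IsGeodesicSegment β p q →
      (∃ t ∈ Set.Icc 0 (dist p q), dist v (β t) ≤ ε) → dist p v ≤ dist p q + ε := by
    rintro p q β v hβ ⟨t, ht, hd⟩
    have h1 := hβ.dist_left ht
    have h2 := dist_triangle_right p v (β t)
    linarith [ht.2]
  obtain ⟨O₀, hO₀⟩ := ClusterOrder.exists_isOrderedBy (E := E) (ε' := ε') hZ (hf.mono hW)
    (by linarith) (by linarith) (by linarith) (fun v _ => by simp)
    (fun v hv => by linarith [hend hγ (hnear v (hW hv))])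
  obtain ⟨O₀', hO₀'⟩ := ClusterOrder.exists_isOrderedBy (E := E) (ε' := ε') hZ (hf'.mono hW'')
    (by linarith) (by linarith) (by linarith) (fun v _ => by simp)
    (fun v hv => by linarith [hend hγ' (hnear' v (hW'' hv))])
  refine ⟨⟨O₀⟩, ⟨O₀'⟩, fun O O' => ?_⟩
  have hO : O.IsOrderedBy (dist a) := hO₀.congr
  -- Replacing `a'` by `a` changes differences of the coordinate by at most `2ε`, less than the
  -- spacing `E - η` of clusters.
  have hO' : O'.IsOrderedBy (dist a) := by
    intro i j hij u hu w hw
    have h1 := (O'.isCluster i).le_dist (O'.isCluster j)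
      (fun h => hij.ne (O'.cluster_injective h)) hu hw
    have h2 := ClusterOrder.dist_le_of_mem_cluster hf' hO₀'.congr hW'' hij hu hw
    have h3 := dist_triangle a' a w
    have h4 := dist_triangle a a' u
    have h5 := hadm.dist_a
    rw [dist_comm a' a] at h3
    linarith
  have key : ∀ r₁ r₂ : ℕ, ∀ {k : ℕ} {e : Fin k → Fin O.n × Fin O'.n}
      (h : (ClusterOrder.layout lam hf hO hW).IsMatching (ClusterOrder.layout lam hf hO' hW')
        M r₁ r₂ e),
      StablyCompatible lam O O'
        (h.decomposition hM (O.edgeLo lam) (O.edgeLo_add_edgeLen_le lam))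
        (h.swap.decomposition hM (O'.edgeLo lam) (O'.edgeLo_add_edgeLen_le lam))
        ((Y : Set Z) ∩ Y') (L r₁ r₂) := by
    intro r₁ r₂ k e h
    have := hKg r₁ r₂
    refine ClusterOrder.stablyCompatible_decomposition (K := K) (g := g r₁ r₂) hZ hf hO hW hO' hW' h
      hM (by linarith) (by linarith) hadm.ncard_symmDiff_le (by linarith [hadm.dist_a])
      (by linarith [hadm.dist_b]) (fun v hv => by linarith [hend hγ (hnear v hv)]) le_rfl ?_ ?_ ?_
    all_goals
      simp only [L]
      linarith
  have hpos : ∀ i, 0 < O.edgeLen i := fun i => by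
    have := O.le_edgeLen i
    have h0 : (0 : ℝ) < O.edgeLen i := by linarith
    exact_mod_cast h0
  have hpos' : ∀ i, 0 < O'.edgeLen i := fun i => by
    have := O'.le_edgeLen i
    have h0 : (0 : ℝ) < O'.edgeLen i := by linarith
    exact_mod_cast h0
  obtain ⟨k, e, he⟩ := (ClusterOrder.layout lam hf hO hW).exists_isMatching
    (ClusterOrder.layout lam hf hO' hW') M 0 0 hM
  obtain ⟨m, e₁, he₁⟩ := (ClusterOrder.layout lam hf hO hW).exists_isMatching
    (ClusterOrder.layout lam hf hO' hW') M r₁ r₂ hM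
  rw [O.edgeSeg_eq_trimmedSeg lam hpos, O'.edgeSeg_eq_trimmedSeg lam hpos',
    O.thickEdgeSeg_eq_trimmedSeg lam hr₁, O'.thickEdgeSeg_eq_trimmedSeg lam hr₁]
  refine ⟨k, _, _, key 0 0 he, m, _, _, key r₁ r₂ he₁, fun i => ?_, fun i => ?_⟩
  · exact he₁.seg_subset_seg hM _ _ he i
  · exact he₁.swap.seg_subset_seg hM _ _ he.swap i
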